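/- Let $f:[1,\infty)\to[1,\infty)$ be a smooth increasing function with $f(t)\le t^{1/2}$. Let $\Omega\subset\mathbb C^n$ be a pseudoconvex domain with $C^2$-smooth boundary $b\Omega$, let $\delta_\Omega(z)$ be the Euclidean distance from $z$ to $b\Omega$, and let $z_0\in b\Omega$. Assume that $\Omega$ has the $f$-Property at $z_0$, that is, there exist an open neighborhood $U$ of $z_0$, a $C^2$ defining function $r$ of $\Omega$ on $U$ (so that $\Omega\cap U=\{z\in U: r(z)<0\}$ and $dr\neq0$ where $r=0$), constants $c,C>0$, and functions $\phi_\delta$, $0<\delta\le1$, such that for every $\delta\in(0,1]$: (i) $\phi_\delta$ is plurisubharmonic and $C^2$ on $U\cap\Omega$, and $-1\le\phi_\delta\le0$ there; (ii) $\displaystyle\sum_{j,k}\frac{\partial^2\phi_\delta}{\partial z_j\partial\bar z_k}(z)X_j\bar X_k\ge c\,f(\delta^{-1})^2|X|^2$ for all $X\in\mathbb C^n$, and $|D\phi_\delta(z)|\le C\delta^{-1}$, for every $z\in U\cap\Omega$ with $-\delta<r(z)<0$. Assume further that $\displaystyle\int_t^\infty\frac{da}{a f(a)}<\infty$ for some $t>1$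 (equivalently, for all $t\ge1$), and put $g(t)=\Big(\displaystyle\int_t^\infty\frac{da}{a f(a)}\Big)^{-1}$. Then there are a neighborhood $V$ of $z_0$ and a constant $C'>0$ such that $$K(z,X)\ge C'\,g(\delta_\Omega(z)^{-1})\,|X|\qquad\text{for all } z\in V\cap\Omega,\ X\in\mathbb C^n,$$ where $K(z,X)=\inf\{\alpha>0:\ \exists\, h:\Delta\to\Omega \text{ holomorphic},\ h(0)=z,\ h'(0)=\alpha^{-1}X\}$ is the Kobayashi metric of $\Omega$ and $\Delta$ is the open unit disc in $\mathbb C$. -/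

import Mathlib

open scoped ContDiff

noncomputable section

namespace KobayashiBound

/-- Complex Euclidean space `ℂⁿ`, with its Euclidean norm. -/
abbrev Cn (n : ℕ) : Type := EuclideanSpace ℂ (Fin n)

/-- `δ_Ω(z)`, the Euclidean distance from `z` to the boundary of `Ω`. -/
def bdist {n : ℕ} (Ω : Set (Cn n)) (z : Cn n) : ℝ :=
  Metric.infDist z (frontier Ω)

/-- A (finite valued) function `u` is plurisubharmonic on the set `D` (to be used with `D` open):
it is upper semicontinuous and satisfies the sub-mean value inequality on every closed affine
complex disc contained in `D`. Since `u a` is finite, the requirement that `u` be integrable on the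
boundary circle is part of the sub-mean value inequality. -/
def PSHOn {n : ℕ} (u : Cn n → ℝ) (D : Set (Cn n)) : Prop :=
  UpperSemicontinuousOn u D ∧
    ∀ a X : Cn n, (∀ ζ : ℂ, ‖ζ‖ ≤ 1 → a + ζ • X ∈ D) →
      CircleIntegrable (fun ζ : ℂ => u (a + ζ • X)) 0 1 ∧
        u a ≤ Real.circleAverage (fun ζ : ℂ => u (a + ζ • X)) 0 1

/-- An open set is pseudoconvex if `-log δ_Ω` is plurisubharmonic on it. -/
def Pseudoconvex {n : ℕ} (Ω : Set (Cn n)) : Prop :=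
  IsOpen Ω ∧ PSHOn (fun z => -Real.log (bdist Ω z)) Ω

/-- `r` is a `C²` defining function of `Ω` on the open set `U`: `Ω ∩ U = {z ∈ U | r z < 0}`, and
`dr ≠ 0` wherever `r` vanishes in `U`. -/
def IsDefiningFunctionOn {n : ℕ} (Ω U : Set (Cn n)) (r : Cn n → ℝ) : Prop :=
  ContDiffOn ℝ 2 r U ∧ (∀ z ∈ U, z ∈ Ω ↔ r z < 0) ∧ ∀ z ∈ U, r z = 0 → fderiv ℝ r z ≠ 0

/-- `Ω` has `C²`-smooth boundary. -/
def HasC2Boundary {n : ℕ} (Ω : Set (Cn n)) : Prop :=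
  ∀ p ∈ frontier Ω, ∃ U : Set (Cn n), IsOpen U ∧ p ∈ U ∧ ∃ r, IsDefiningFunctionOn Ω U r

/-- The Levi form `∂∂̄φ(z)(X, X̄) = ∑ⱼₖ (∂²φ/∂zⱼ∂z̄ₖ)(z) Xⱼ X̄ₖ` of a `C²` function, written through
the real second derivative as `(D²φ(X, X) + D²φ(iX, iX)) / 4`. -/
def leviForm {n : ℕ} (φ : Cn n → ℝ) (z X : Cn n) : ℝ :=
  (fderiv ℝ (fderiv ℝ φ) z X X
    + fderiv ℝ (fderiv ℝ φ) z (Complex.I • X) (Complex.I • X)) / 4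

/-- `f : [1, ∞) → [1, ∞)` is smooth, increasing, and `f t ≤ t ^ (1/2)`; only the values of `f` on
`[1, ∞)` matter. -/
def IsRate (f : ℝ → ℝ) : Prop :=
  ContDiffOn ℝ ∞ f (Set.Ici 1) ∧ MonotoneOn f (Set.Ici 1) ∧
    ∀ t : ℝ, 1 ≤ t → 1 ≤ f t ∧ f t ≤ t ^ (1 / 2 : ℝ)

/-- The `f`-Property of `Ω` at `z₀`. The functions `φ δ`, `0 < δ ≤ 1`, live on the part of the
neighborhood `U` that lies in `Ω`; the constants `c`, `C` do not depend on `δ`. -/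
def FProperty {n : ℕ} (Ω : Set (Cn n)) (z₀ : Cn n) (f : ℝ → ℝ) : Prop :=
  ∃ U : Set (Cn n), IsOpen U ∧ z₀ ∈ U ∧
  ∃ r : Cn n → ℝ, IsDefiningFunctionOn Ω U r ∧
  ∃ φ : ℝ → Cn n → ℝ, ∃ c C : ℝ, 0 < c ∧ 0 < C ∧
    ∀ δ : ℝ, 0 < δ → δ ≤ 1 →
      ContDiffOn ℝ 2 (φ δ) (U ∩ Ω) ∧
      PSHOn (φ δ) (U ∩ Ω) ∧
      (∀ z ∈ U ∩ Ω, -1 ≤ φ δ z ∧ φ δ z ≤ 0) ∧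
      ∀ z ∈ U ∩ Ω, -δ < r z → r z < 0 →
        (∀ X : Cn n, c * f δ⁻¹ ^ 2 * ‖X‖ ^ 2 ≤ leviForm (φ δ) z X) ∧
        ‖fderiv ℝ (φ δ) z‖ ≤ C * δ⁻¹

/-- `g(t) = (∫ₜ^∞ da / (a f(a)))⁻¹`. -/
def rateG (f : ℝ → ℝ) (t : ℝ) : ℝ :=
  (∫ a in Set.Ioi t, 1 / (a * f a))⁻¹

/-- The Kobayashi metric of `Ω`: the infimum of all `α > 0` such that some holomorphic map
`h` from the unit disc to `Ω` has `h(0) = z` and `h'(0) = α⁻¹ X`. -/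
def kobayashi {n : ℕ} (Ω : Set (Cn n)) (z X : Cn n) : ℝ :=
  sInf {α : ℝ | 0 < α ∧ ∃ h : ℂ → Cn n,
    DifferentiableOn ℂ h (Metric.ball 0 1) ∧ Set.MapsTo h (Metric.ball 0 1) Ω ∧
      h 0 = z ∧ deriv h 0 = (α : ℂ)⁻¹ • X}

end KobayashiBound

end

/-! The argument gives a stronger bound, K(z,X) ≥ const · f(e/δ_Ω(z)) |X|. Integrating 1/(a f(a))
over [t, et] shows g(t) ≤ f(et) (`IsRate.rateG_le`). Apart from this, convergence of the integral
only serves to make f unbounded.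

Discs are controlled by a plurisubharmonic function with a logarithmic pole. Suppose Θ + log|z-p|²
is plurisubharmonic on Ω and at most C, and let h(0) = p. With q(ζ) = (h(ζ)-p)/ζ, the function
log|q|² + Θ∘h is subharmonic, and the maximum principle on |ζ| ≤ 1/2 gives |h'(0)|² e^{Θ(p)} ≤ 4e^C
(`IsPolar.sq_deriv_mul_exp_le`). So Θ is needed with C independent of p and Θ(p) ≥ 2 log f(e/δ_Ω(p))
- O(1).

Where a function u with values in [-1,0] has Levi form at least K ~ f², the local candidate is u -
K|z-p|² + log K. Its sum with log|z-p|² is bounded uniformly in K, because log s - s ≤ -1. A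
multiple of `layer` makes it small at the inner edge of the strip, so that a maximum glues it to a
function of the same kind at the next scale (`HasPolar.step`). That scale has a strip 5/4 times
wider and a Levi bound smaller by `widenLoss` (`HasStrip.widen`). Since only maxima are taken, C
does not grow along the chain. Since `widenLoss` ≤ 1/2 and f(t)² ≤ t, the product Kδ stays bounded,
so the strips stay thin until K has dropped to a fixed size, where `exists_isPolar` supplies the
global function.

Maxima destroy smoothness, so plurisubharmonicity is carried by `SubmeanAt`, an infinitesimal
condition on affine discs. It passes to holomorphic discs by doubling of variables
(`not_isLocalMax`). -/

namespace KobayashiBound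

open Filter Topology Metric Real

/-! ### Calculus of the infinitesimal sub-mean value inequality. -/

section Submean

variable {E : Type*} [NormedAddCommGroup E] [NormedSpace ℂ E]

/-- Infinitesimal sub-mean value inequality with gain `K`: the circle averages of `u` over small
affine discs of direction `X` centred at `a` exceed `u a` by `K r² ‖X‖²`, up to `o(r²)`. -/
def SubmeanAt (K : ℝ) (u : E → ℝ) (a : E) : Prop :=
  (∀ᶠ z in 𝓝 a, ContinuousAt u z) ∧
    ∀ X : E, ∀ ε > 0, ∀ᶠ r in 𝓝[>] (0 : ℝ),
      u a + K * r ^ 2 * ‖X‖ ^ 2 ≤ circleAverage (fun ζ : ℂ => u (a + ζ • X)) 0 r + ε * r ^ 2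

lemma eventually_disc {P : E → Prop} {a : E} (h : ∀ᶠ z in 𝓝 a, P z) (X : E) :
    ∀ᶠ r in 𝓝[>] (0 : ℝ), 0 < r ∧ ∀ ζ : ℂ, ‖ζ‖ ≤ r → P (a + ζ • X) := by
  have hc : Tendsto (fun ζ : ℂ => a + ζ • X) (𝓝 0) (𝓝 a) := by
    have : Continuous (fun ζ : ℂ => a + ζ • X) := by fun_prop
    simpa using this.tendsto 0
  obtain ⟨ε, hε, H⟩ := Metric.eventually_nhds_iff_ball.1 (hc.eventually h)
  filter_upwards [Ioo_mem_nhdsGT hε] with r hr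
  refine ⟨hr.1, fun ζ hζ => H ζ ?_⟩
  simpa using hζ.trans_lt hr.2

lemma eventually_circleIntegrable {u : E → ℝ} {a : E} (h : ∀ᶠ z in 𝓝 a, ContinuousAt u z) (X : E) :
    ∀ᶠ r in 𝓝[>] (0 : ℝ), CircleIntegrable (fun ζ : ℂ => u (a + ζ • X)) 0 r := by
  filter_upwards [eventually_disc h X] with r hr
  refine ContinuousOn.circleIntegrable hr.1.le fun ζ hζ => ContinuousAt.continuousWithinAt ?_
  have h1 : ContinuousAt u (a + ζ • X) := hr.2 ζ (by simpa using (mem_sphere_zero_iff_norm.1 hζ).le)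
  exact ContinuousAt.comp' h1 (by fun_prop)

lemma SubmeanAt.mono {K K' : ℝ} {u : E → ℝ} {a : E} (h : SubmeanAt K u a) (hK : K' ≤ K) :
    SubmeanAt K' u a := by
  refine ⟨h.1, fun X ε hε => ?_⟩
  filter_upwards [h.2 X ε hε] with r hr
  refine le_trans ?_ hr
  gcongr

lemma SubmeanAt.add {K K' : ℝ} {u v : E → ℝ} {a : E} (hu : SubmeanAt K u a)
    (hv : SubmeanAt K' v a) : SubmeanAt (K + K') (fun z => u z + v z) a := by
  refine ⟨by filter_upwards [hu.1, hv.1] with z h1 h2 using h1.add h2, fun X ε hε => ?_⟩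
  filter_upwards [hu.2 X (ε / 2) (by positivity), hv.2 X (ε / 2) (by positivity),
    eventually_circleIntegrable hu.1 X, eventually_circleIntegrable hv.1 X] with r h1 h2 h3 h4
  rw [circleAverage_fun_add h3 h4]
  linarith

lemma submeanAt_const (c : ℝ) (a : E) : SubmeanAt 0 (fun _ => c) a := by
  refine ⟨Eventually.of_forall fun z => continuousAt_const, fun X ε hε => ?_⟩
  refine Eventually.of_forall fun r => ?_
  rw [circleAverage_const]
  nlinarith [sq_nonneg r]

lemma SubmeanAt.add_const {K : ℝ} {u : E → ℝ} {a : E} (hu : SubmeanAt K u a) (c : ℝ) :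
    SubmeanAt K (fun z => u z + c) a := by
  simpa using hu.add (submeanAt_const c a)

lemma SubmeanAt.const_mul {K : ℝ} {u : E → ℝ} {a : E} (hu : SubmeanAt K u a) {c : ℝ}
    (hc : 0 ≤ c) : SubmeanAt (c * K) (fun z => c * u z) a := by
  refine ⟨by filter_upwards [hu.1] with z h1 using continuousAt_const.mul h1, fun X ε hε => ?_⟩
  filter_upwards [hu.2 X (ε / (c + 1)) (by positivity)] with r hr
  have h1 : circleAverage (fun ζ : ℂ => c * u (a + ζ • X)) 0 r
      = c * circleAverage (fun ζ : ℂ => u (a + ζ • X)) 0 r := by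
    simpa using circleAverage_fun_smul (f := fun ζ : ℂ => u (a + ζ • X)) (c := 0) (R := r) (a := c)
  rw [h1]
  have h2 : c * (ε / (c + 1)) ≤ ε := by
    rw [mul_div_assoc', div_le_iff₀ (by positivity)]; nlinarith
  have h3 := mul_le_mul_of_nonneg_left hr hc
  nlinarith [mul_le_mul_of_nonneg_right h2 (sq_nonneg r)]

/-- A function inherits the sub-mean value inequality from a minorant touching it at the point. -/
lemma SubmeanAt.of_le {K : ℝ} {u v : E → ℝ} {a : E} (hu : SubmeanAt K u a)
    (hv : ∀ᶠ z in 𝓝 a, ContinuousAt v z) (heq : v a = u a) (hle : ∀ᶠ z in 𝓝 a, u z ≤ v z) :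
    SubmeanAt K v a := by
  refine ⟨hv, fun X ε hε => ?_⟩
  filter_upwards [hu.2 X ε hε, eventually_circleIntegrable hu.1 X,
    eventually_circleIntegrable hv X, eventually_disc hle X] with r h1 h2 h3 h4
  rw [heq]
  refine h1.trans ?_
  refine add_le_add_left ?_ _
  refine circleAverage_mono h2 h3 fun ζ hζ => h4.2 ζ ?_
  rw [abs_of_pos h4.1, mem_sphere_zero_iff_norm] at hζ
  exact hζ.le

lemma SubmeanAt.congr {K : ℝ} {u v : E → ℝ} {a : E} (hu : SubmeanAt K u a)
    (h : ∀ᶠ z in 𝓝 a, u z = v z) : SubmeanAt K v a := by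
  refine hu.of_le ?_ h.self_of_nhds.symm (h.mono fun z hz => hz.le)
  filter_upwards [hu.1, eventually_eventually_nhds.2 h] with z h1 h2 using h1.congr h2

lemma SubmeanAt.max {K : ℝ} {u v : E → ℝ} {a : E} (hu : SubmeanAt K u a) (hv : SubmeanAt K v a) :
    SubmeanAt K (fun z => max (u z) (v z)) a := by
  have hc : ∀ᶠ z in 𝓝 a, ContinuousAt (fun z => Max.max (u z) (v z)) z := by
    filter_upwards [hu.1, hv.1] with z h1 h2 using h1.max h2
  rcases le_total (u a) (v a) with h | h
  · exact hv.of_le hc (max_eq_right h) (Eventually.of_forall fun z => le_max_right _ _)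
  · exact hu.of_le hc (max_eq_left h) (Eventually.of_forall fun z => le_max_left _ _)

lemma SubmeanAt.comp_add_right {K : ℝ} {u : E → ℝ} {a b : E} (hu : SubmeanAt K u (a + b)) :
    SubmeanAt K (fun z => u (z + b)) a := by
  have hc : Tendsto (fun z : E => z + b) (𝓝 a) (𝓝 (a + b)) :=
    (continuous_id.add continuous_const).tendsto a
  refine ⟨?_, fun X ε hε => ?_⟩
  · filter_upwards [hc.eventually hu.1] with z hz
    exact ContinuousAt.comp' hz (by fun_prop)
  · filter_upwards [hu.2 X ε hε] with r hr
    simpa only [add_right_comm] using hr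

lemma circleAverage_re {F : ℂ → ℂ} (hF : Differentiable ℂ F) (r : ℝ) :
    circleAverage (fun ζ => (F ζ).re) 0 r = (F 0).re := by
  have h1 := Complex.reCLM.circleAverage_comp_comm (f := F) (c := 0) (R := r)
    (ContinuousOn.circleIntegrable' (hF.continuous.continuousOn))
  rw [(hF.diffContOnCl).circleAverage] at h1
  exact h1

lemma circleIntegrable_of_continuous {f : ℂ → ℝ} (hf : Continuous f) (c : ℂ) (r : ℝ) :
    CircleIntegrable f c r := hf.continuousOn.circleIntegrable'

/-- Sub-mean value inequality for `log ‖G‖` and its negative, `G` holomorphic without zeros. -/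
lemma submeanAt_log_norm {G : E → ℂ} {a : E} (hG : AnalyticAt ℂ G a) (h0 : G a ≠ 0) (c : ℝ) :
    SubmeanAt 0 (fun z => c * log ‖G z‖) a := by
  have hne : ∀ᶠ z in 𝓝 a, G z ≠ 0 := hG.continuousAt.eventually_ne h0
  refine ⟨?_, fun X ε hε => ?_⟩
  · filter_upwards [hne, hG.eventually_continuousAt] with z h1 h2
    exact continuousAt_const.mul (h2.norm.log (norm_ne_zero_iff.2 h1))
  · filter_upwards [eventually_disc (hne.and hG.eventually_analyticAt) X] with r hr
    have key : circleAverage (fun ζ : ℂ => log ‖G (a + ζ • X)‖) 0 r = log ‖G a‖ := by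
      have := InnerProductSpace.HarmonicOnNhd.circleAverage_eq
        (f := fun ζ : ℂ => log ‖G (a + ζ • X)‖) (c := 0) (R := r) (fun ζ hζ => by
          have h := hr.2 ζ (by simpa [abs_of_pos hr.1] using hζ)
          refine AnalyticAt.harmonicAt_log_norm (f := fun ζ : ℂ => G (a + ζ • X)) ?_ h.1
          exact AnalyticAt.fun_comp h.2 (by fun_prop))
      simpa using this
    have h1 : circleAverage (fun ζ : ℂ => c * log ‖G (a + ζ • X)‖) 0 r = c * log ‖G a‖ := by
      rw [← key]
      simpa using circleAverage_fun_smul (f := fun ζ : ℂ => log ‖G (a + ζ • X)‖) (c := 0)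
        (R := r) (a := c)
    rw [h1]
    have : 0 ≤ ε * r ^ 2 := by positivity
    linarith

end Submean

/-! ### Squared distance and its logarithm. -/

section Inner

variable {E : Type*} [NormedAddCommGroup E] [InnerProductSpace ℂ E]

lemma circleAverage_normSq (v X : E) (r : ℝ) :
    circleAverage (fun ζ : ℂ => ‖v + ζ • X‖ ^ 2) 0 r = ‖v‖ ^ 2 + r ^ 2 * ‖X‖ ^ 2 := by
  have h1 : Set.EqOn (fun ζ : ℂ => ‖v + ζ • X‖ ^ 2)
      (fun ζ : ℂ => (((‖v‖ ^ 2 + r ^ 2 * ‖X‖ ^ 2 : ℝ) : ℂ) + 2 * (ζ * inner ℂ v X)).re)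
      (sphere 0 |r|) := by
    intro ζ hζ
    have h2 : ‖ζ‖ ^ 2 = r ^ 2 := by rw [mem_sphere_zero_iff_norm.1 hζ, sq_abs]
    have := norm_add_sq (𝕜 := ℂ) v (ζ • X)
    simp only [inner_smul_right, norm_smul, mul_pow, h2, RCLike.re_to_complex] at this
    simp only [this, Complex.add_re, Complex.ofReal_re]
    rw [show ((2 : ℂ) * (ζ * inner ℂ v X)).re = 2 * (ζ * inner ℂ v X).re from by simp]
    ring
  rw [circleAverage_congr_sphere h1, circleAverage_re (by fun_prop)]
  simp only [zero_mul, mul_zero, add_zero, Complex.ofReal_re]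

lemma submeanAt_normSq (K : ℝ) (p a : E) : SubmeanAt K (fun z => K * ‖z - p‖ ^ 2) a := by
  refine ⟨Eventually.of_forall fun z => by fun_prop, fun X ε hε => Eventually.of_forall fun r => ?_⟩
  have h1 : circleAverage (fun ζ : ℂ => K * ‖a + ζ • X - p‖ ^ 2) 0 r
      = K * (‖a - p‖ ^ 2 + r ^ 2 * ‖X‖ ^ 2) := by
    rw [← circleAverage_normSq]
    simpa [add_sub_right_comm] using circleAverage_fun_smul
      (f := fun ζ : ℂ => ‖(a - p) + ζ • X‖ ^ 2) (c := 0) (R := r) (a := K)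
  rw [h1]
  have : 0 ≤ ε * r ^ 2 := by positivity
  nlinarith

/-- With v = a - p, Cauchy–Schwarz gives the pluriharmonic minorant 2 log|⟨v, z-p⟩| - 2 log|v|,
which touches log|z-p|² at a. -/
lemma submeanAt_log_dist {p a : E} (h : a ≠ p) : SubmeanAt 0 (fun z => log (‖z - p‖ ^ 2)) a := by
  have h0 : a - p ≠ 0 := sub_ne_zero.2 h
  obtain ⟨v, hv⟩ : ∃ v, v = a - p := ⟨_, rfl⟩
  rw [← hv] at h0
  have hvn : 0 < ‖v‖ := norm_pos_iff.2 h0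
  have hG : AnalyticAt ℂ (fun z : E => inner ℂ v (z - p)) a := by
    have : AnalyticAt ℂ (fun z : E => (innerSL ℂ v) (z - p)) a :=
      ((innerSL ℂ v).analyticAt _).fun_comp (by fun_prop)
    simpa only [innerSL_apply_apply] using this
  have hva : inner ℂ v (a - p) = ((‖v‖ ^ 2 : ℝ) : ℂ) := by
    rw [← hv, inner_self_eq_norm_sq_to_K]; simp
  have hne : inner ℂ v (a - p) ≠ 0 := by rw [hva]; exact_mod_cast (by positivity)
  have h1 := (submeanAt_log_norm hG hne 2).add_const (-2 * log ‖v‖)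
  refine h1.of_le ?_ ?_ ?_
  · filter_upwards [isOpen_ne.mem_nhds h] with z hz
    exact ContinuousAt.log (by fun_prop) (by simpa [sub_eq_zero] using hz)
  · rw [hva, ← hv]
    simp only [Complex.norm_real, norm_pow, norm_norm, log_pow]
    push_cast; ring
  · filter_upwards [hG.continuousAt.eventually_ne hne] with z hz
    have h2 : ‖inner ℂ v (z - p)‖ ≤ ‖v‖ * ‖z - p‖ := norm_inner_le_norm _ _
    have h3 : 0 < ‖inner ℂ v (z - p)‖ := norm_pos_iff.2 hz
    have h4 : 0 < ‖z - p‖ := by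
      by_contra h5
      have : ‖z - p‖ = 0 := le_antisymm (not_lt.1 h5) (norm_nonneg _)
      rw [this] at h2; linarith
    have h5 := log_le_log h3 h2
    rw [log_mul hvn.ne' h4.ne'] at h5
    rw [log_pow]; push_cast; linarith

end Inner

end KobayashiBound

/-! ### From the Levi form and from `PSHOn` to `SubmeanAt`. -/

namespace KobayashiBound

open Filter Topology Metric Real

lemma taylor_two {E : Type*} [NormedAddCommGroup E] [NormedSpace ℝ E] {φ : E → ℝ} {a : E}
    (hφ : ContDiffAt ℝ 2 φ a) {ε : ℝ} (hε : 0 < ε) :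
    ∀ᶠ z in 𝓝 a, |φ z - φ a - fderiv ℝ φ a (z - a)
      - fderiv ℝ (fderiv ℝ φ) a (z - a) (z - a) / 2| ≤ ε * ‖z - a‖ ^ 2 := by
  have hd : ∀ᶠ z in 𝓝 a, DifferentiableAt ℝ φ z := by
    filter_upwards [hφ.eventually (by simp)] with z hz using hz.differentiableAt (by simp)
  have h2 : HasFDerivAt (fderiv ℝ φ) (fderiv ℝ (fderiv ℝ φ) a) a :=
    ((hφ.fderiv_right (m := 1) (by norm_num)).differentiableAt (by simp)).hasFDerivAt
  have h3 := hd.and (h2.isLittleO.def hε)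
  obtain ⟨δ, hδ, H⟩ := Metric.eventually_nhds_iff_ball.1 h3
  filter_upwards [ball_mem_nhds a hδ] with z hz
  set v := z - a with hv
  set A := fderiv ℝ (fderiv ℝ φ) a
  have hvδ : ‖v‖ < δ := by simpa [hv, dist_eq_norm] using hz
  have hin : ∀ t ∈ Set.Icc (0 : ℝ) 1, a + t • v ∈ ball a δ := by
    intro t ht
    have : t * ‖v‖ ≤ 1 * ‖v‖ := mul_le_mul_of_nonneg_right ht.2 (norm_nonneg _)
    simp only [mem_ball, dist_eq_norm, add_sub_cancel_left, norm_smul, Real.norm_eq_abs,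
      abs_of_nonneg ht.1]
    linarith
  have key := norm_image_sub_le_of_norm_deriv_le_segment_01'
    (f := fun t : ℝ => φ (a + t • v) - t * fderiv ℝ φ a v - t ^ 2 / 2 * A v v)
    (f' := fun t : ℝ => fderiv ℝ φ (a + t • v) v - fderiv ℝ φ a v - t * A v v)
    (C := ε * ‖v‖ ^ 2) ?_ ?_
  · have e : a + v = z := by simp [hv]
    simp only [one_smul, zero_smul, add_zero, e, one_mul, one_pow, zero_mul, sub_zero, ne_eq,
      OfNat.ofNat_ne_zero, not_false_eq_true, zero_pow, zero_div, Real.norm_eq_abs] at key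
    convert key using 2
    ring
  · intro t ht
    have h4 : HasDerivAt (fun t : ℝ => a + t • v) v t := by
      simpa using ((hasDerivAt_id t).smul_const v).const_add a
    have h5 : HasDerivAt (fun t : ℝ => φ (a + t • v)) (fderiv ℝ φ (a + t • v) v) t :=
      (H _ (hin t ht)).1.hasFDerivAt.comp_hasDerivAt t h4
    have h6 : HasDerivAt (fun t : ℝ => t * fderiv ℝ φ a v) (fderiv ℝ φ a v) t := by
      simpa using (hasDerivAt_id t).mul_const (fderiv ℝ φ a v)
    have h7 : HasDerivAt (fun t : ℝ => t ^ 2 / 2 * A v v) (t * A v v) t := by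
      have := (((hasDerivAt_id t).pow 2).div_const 2).mul_const (A v v)
      refine this.congr_deriv ?_
      simp
    exact ((h5.sub h6).sub h7).hasDerivWithinAt
  · intro t ht
    have ht' : t ∈ Set.Icc (0 : ℝ) 1 := ⟨ht.1, ht.2.le⟩
    have h8 := (H _ (hin t ht')).2
    rw [add_sub_cancel_left, map_smul, norm_smul, Real.norm_eq_abs, abs_of_nonneg ht.1] at h8
    have h9 := (fderiv ℝ φ (a + t • v) - fderiv ℝ φ a - t • A v).le_opNorm v
    simp only [sub_apply, smul_apply, smul_eq_mul] at h9
    refine h9.trans ?_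
    have h10 : t * ‖v‖ ≤ ‖v‖ := mul_le_of_le_one_left (norm_nonneg _) ht.2.le
    calc _ ≤ ε * (t * ‖v‖) * ‖v‖ := by gcongr
      _ ≤ ε * ‖v‖ * ‖v‖ := by gcongr
      _ = _ := by ring

variable {n : ℕ}

/-- On the circle |ζ| = r the quadratic polynomial is the real part of a holomorphic polynomial plus
r² times the Levi term, and only the constant survives averaging. -/
lemma circleAverage_bilin (L : Cn n →L[ℝ] ℝ) (A : Cn n →L[ℝ] Cn n →L[ℝ] ℝ) (X : Cn n) (r : ℝ) :
    circleAverage (fun ζ : ℂ => L (ζ • X) + A (ζ • X) (ζ • X) / 2) 0 r =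
      r ^ 2 * ((A X X + A (Complex.I • X) (Complex.I • X)) / 4) := by
  set Y := Complex.I • X with hY
  have hs : ∀ ζ : ℂ, ζ • X = ζ.re • X + ζ.im • Y := by
    intro ζ
    conv_lhs => rw [← Complex.re_add_im ζ]
    rw [add_smul, mul_smul, ← hY]
    congr 1
  have h1 : Set.EqOn (fun ζ : ℂ => L (ζ • X) + A (ζ • X) (ζ • X) / 2)
      (fun ζ : ℂ => (((L X : ℂ) - L Y * Complex.I) * ζ + ((A X X - A Y Y) / 4 : ℝ) * ζ ^ 2
        - ((A X Y + A Y X) / 4 : ℝ) * Complex.I * ζ ^ 2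
        + (r ^ 2 * ((A X X + A Y Y) / 4) : ℝ)).re) (sphere 0 |r|) := by
    intro ζ hζ
    have h2 : ζ.re ^ 2 + ζ.im ^ 2 = r ^ 2 := by
      have h3 := mem_sphere_zero_iff_norm.1 hζ
      rw [← sq_abs r, ← h3, ← Complex.normSq_eq_norm_sq, Complex.normSq_apply]; ring
    simp only [hs ζ, map_add, map_smul, add_apply,
      smul_apply, smul_eq_mul, ← h2, pow_two, Complex.add_re, Complex.sub_re,
      Complex.mul_re, Complex.mul_im, Complex.sub_im, Complex.ofReal_re, Complex.ofReal_im,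
      Complex.I_re, Complex.I_im]
    ring
  rw [circleAverage_congr_sphere h1, circleAverage_re (by fun_prop)]
  simp only [mul_zero, ne_eq, OfNat.ofNat_ne_zero, not_false_eq_true, zero_pow, add_zero, sub_zero,
    zero_add, Complex.ofReal_re]

lemma submeanAt_of_leviForm {φ : Cn n → ℝ} {a : Cn n} (hφ : ContDiffAt ℝ 2 φ a) {K : ℝ}
    (h : ∀ X, K * ‖X‖ ^ 2 ≤ leviForm φ a X) : SubmeanAt K φ a := by
  have hc : ∀ᶠ z in 𝓝 a, ContinuousAt φ z := by
    filter_upwards [hφ.eventually (by simp)] with z hz using hz.continuousAt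
  refine ⟨hc, fun X ε hε => ?_⟩
  set η := ε / (‖X‖ ^ 2 + 1) with hη
  have hη0 : 0 < η := by positivity
  have hηX : η * ‖X‖ ^ 2 ≤ ε := by
    rw [hη, div_mul_eq_mul_div, div_le_iff₀ (by positivity)]; nlinarith
  filter_upwards [eventually_circleIntegrable hc X,
    eventually_disc (taylor_two hφ hη0) X] with r h1 h2
  set L := fderiv ℝ φ a
  set A := fderiv ℝ (fderiv ℝ φ) a
  have hci : CircleIntegrable (fun ζ : ℂ => L (ζ • X) + A (ζ • X) (ζ • X) / 2) 0 r :=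
    circleIntegrable_of_continuous (by fun_prop) _ _
  have h3 : circleAverage (fun ζ : ℂ => L (ζ • X) + A (ζ • X) (ζ • X) / 2) 0 r ≤
      circleAverage (fun ζ : ℂ => φ (a + ζ • X) + (ε * r ^ 2 - φ a)) 0 r := by
    refine circleAverage_mono hci (h1.add (circleIntegrable_const _ _ _)) fun ζ hζ => ?_
    rw [abs_of_pos h2.1, mem_sphere_zero_iff_norm] at hζ
    have h4 := (abs_le.1 (h2.2 ζ hζ.le)).1
    rw [add_sub_cancel_left, norm_smul, hζ, mul_pow] at h4
    have : η * ‖X‖ ^ 2 * r ^ 2 ≤ ε * r ^ 2 := by gcongr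
    simp only [L, A]
    nlinarith
  rw [circleAverage_bilin, circleAverage_fun_add h1 (circleIntegrable_const _ _ _),
    circleAverage_const] at h3
  have h5 := mul_le_mul_of_nonneg_left (h X) (sq_nonneg r)
  simp only [leviForm] at h5
  simp only [A] at h3
  linarith

lemma submeanAt_of_PSHOn {u : Cn n → ℝ} {D : Set (Cn n)} (hD : IsOpen D) (hc : ContinuousOn u D)
    (hu : PSHOn u D) {a : Cn n} (ha : a ∈ D) : SubmeanAt 0 u a := by
  have hev : ∀ᶠ z in 𝓝 a, z ∈ D := hD.mem_nhds ha
  refine ⟨hev.mono fun z hz => hc.continuousAt (hD.mem_nhds hz), fun X ε hε => ?_⟩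
  filter_upwards [eventually_disc hev X] with r hr
  have h1 := (hu.2 a ((r : ℂ) • X) fun ζ hζ => by
    rw [smul_smul]
    refine hr.2 _ ?_
    rw [norm_mul, Complex.norm_real, Real.norm_eq_abs, abs_of_pos hr.1]
    exact mul_le_of_le_one_left hr.1.le hζ).2
  rw [circleAverage_eq_circleAverage_zero_one]
  simp only [smul_smul, mul_comm _ (r : ℂ), add_zero] at h1 ⊢
  have : 0 ≤ ε * r ^ 2 := by positivity
  linarith

end KobayashiBound

/-! ### Maximum principle along holomorphic discs. -/

namespace KobayashiBound

open Filter Topology Metric Real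

/-- In the expansion of |F|² around F(0) the linear term is the real part of a holomorphic function
vanishing at 0, so its mean is zero. The remainder |F - F(0)|² is o(r²) because F'(0) = 0. -/
lemma circleAverage_normSq_le {E : Type*} [NormedAddCommGroup E] [InnerProductSpace ℂ E]
    [CompleteSpace E] {F : ℂ → E} (hF : AnalyticAt ℂ F 0) (h0 : HasDerivAt F 0 0) {ε : ℝ} (hε : 0 < ε) :
    ∀ᶠ r in 𝓝[>] (0 : ℝ), CircleIntegrable (fun ζ => ‖F ζ‖ ^ 2) 0 r ∧
      circleAverage (fun ζ => ‖F ζ‖ ^ 2) 0 r ≤ ‖F 0‖ ^ 2 + ε * r ^ 2 := by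
  have hs : 0 < √ε := sqrt_pos.2 hε
  have h1 : ∀ᶠ ζ in 𝓝 (0 : ℂ), ‖F ζ - F 0‖ ≤ √ε * ‖ζ‖ := by
    simpa using h0.isLittleO.def hs
  filter_upwards [eventually_disc (h1.and hF.eventually_analyticAt) (1 : ℂ)] with r hr
  simp only [smul_eq_mul, mul_one, zero_add] at hr
  have hd : ∀ ζ : ℂ, ‖ζ‖ ≤ r → DifferentiableAt ℂ F ζ := fun ζ hζ => (hr.2 ζ hζ).2.differentiableAt
  have hint : CircleIntegrable (fun ζ => ‖F ζ‖ ^ 2) 0 r := by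
    refine ContinuousOn.circleIntegrable hr.1.le fun ζ hζ => ?_
    exact ((hd ζ (mem_sphere_zero_iff_norm.1 hζ).le).continuousAt.norm.pow 2).continuousWithinAt
  refine ⟨hint, ?_⟩
  set g : ℂ → ℂ := fun ζ => inner ℂ (F 0) (F ζ - F 0) with hg
  have hgd : ∀ ζ : ℂ, ‖ζ‖ ≤ r → DifferentiableAt ℂ g ζ := fun ζ hζ => by
    have : DifferentiableAt ℂ (fun ζ => innerSL ℂ (F 0) (F ζ - F 0)) ζ :=
      (innerSL ℂ (F 0)).differentiableAt.fun_comp' ζ ((hd ζ hζ).sub_const _)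
    simpa only [innerSL_apply_apply] using this
  have hgc : CircleIntegrable g 0 r := ContinuousOn.circleIntegrable hr.1.le fun ζ hζ =>
    (hgd ζ (mem_sphere_zero_iff_norm.1 hζ).le).continuousAt.continuousWithinAt
  have hgre : CircleIntegrable (fun ζ => 2 * (g ζ).re) 0 r :=
    ContinuousOn.circleIntegrable hr.1.le fun ζ hζ =>
      (continuousAt_const.mul (Complex.continuous_re.continuousAt.comp'
        (hgd ζ (mem_sphere_zero_iff_norm.1 hζ).le).continuousAt)).continuousWithinAt
  have hav : circleAverage (fun ζ => 2 * (g ζ).re) 0 r = 0 := by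
    have h2 := Complex.reCLM.circleAverage_comp_comm hgc
    rw [DiffContOnCl.circleAverage] at h2
    · have h3 : circleAverage (fun ζ => (g ζ).re) 0 r = 0 := by
        refine Eq.trans h2 ?_
        simp [hg]
      simpa [h3] using circleAverage_fun_smul (f := fun ζ => (g ζ).re) (c := 0) (R := r)
        (a := (2 : ℝ))
    · refine DifferentiableOn.diffContOnCl fun ζ hζ => (hgd ζ ?_).differentiableWithinAt
      have := closure_ball_subset_closedBall hζ
      rwa [abs_of_pos hr.1, mem_closedBall_zero_iff] at this
  have hle : circleAverage (fun ζ => ‖F ζ‖ ^ 2) 0 r ≤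
      circleAverage (fun ζ => 2 * (g ζ).re + (‖F 0‖ ^ 2 + ε * r ^ 2)) 0 r := by
    refine circleAverage_mono hint (hgre.add (circleIntegrable_const _ _ _)) fun ζ hζ => ?_
    rw [abs_of_pos hr.1, mem_sphere_zero_iff_norm] at hζ
    have h4 := (hr.2 ζ hζ.le).1
    rw [hζ] at h4
    have h5 := norm_add_sq (𝕜 := ℂ) (F 0) (F ζ - F 0)
    rw [add_sub_cancel, RCLike.re_to_complex] at h5
    have h6 : ‖F ζ - F 0‖ ^ 2 ≤ ε * r ^ 2 := by
      calc _ ≤ (√ε * r) ^ 2 := by gcongr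
        _ = _ := by rw [mul_pow, sq_sqrt hε.le]
    simp only [hg]
    linarith
  rwa [circleAverage_fun_add hgre (circleIntegrable_const _ _ _), circleAverage_const, hav,
    zero_add] at hle

variable {n : ℕ}

/-- Doubling of variables: z is freed from h(ζ) and the penalty k|z - h(ζ)|² is subtracted. For
large k a maximizer on a compact neighbourhood has z close to h(ζ), and strictness of the maximum at
ζ₀ keeps it off the boundary. -/
lemma exists_interior_max {Φ : Cn n → ℝ} {S : ℂ → ℝ} {h : ℂ → Cn n} {ζ₀ : ℂ} {ε : ℝ} (hε : 0 < ε)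
    (hh : ContinuousAt h ζ₀) {P : Cn n → Prop} {Q : ℂ → Prop}
    (hΦ : ∀ᶠ z in 𝓝 (h ζ₀), ContinuousAt Φ z ∧ P z)
    (hS : ∀ᶠ ζ in 𝓝 ζ₀, ContinuousAt S ζ ∧ ContinuousAt h ζ ∧ Q ζ)
    (hmax : ∀ᶠ ζ in 𝓝 ζ₀, Φ (h ζ) + S ζ + ε * ‖ζ - ζ₀‖ ^ 2 ≤ Φ (h ζ₀) + S ζ₀) :
    ∃ z ζ, ∃ k : ℝ, 0 ≤ k ∧ P z ∧ Q ζ ∧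
      IsLocalMax (fun x : Cn n × ℂ => Φ x.1 + S x.2 - k * ‖x.1 - h x.2‖ ^ 2) (z, ζ) := by
  obtain ⟨r₂, hr₂, H2⟩ := Metric.nhds_basis_closedBall.eventually_iff.1 hΦ
  have hb : ∀ᶠ ζ in 𝓝 ζ₀, h ζ ∈ ball (h ζ₀) (r₂ / 2) := hh (ball_mem_nhds _ (by positivity))
  obtain ⟨r₁, hr₁, H1⟩ := Metric.nhds_basis_closedBall.eventually_iff.1 (hS.and (hmax.and hb))
  have hΦc : ContinuousOn Φ (closedBall (h ζ₀) r₂) := fun z hz => (H2 hz).1.continuousWithinAt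
  have hu := (isCompact_closedBall (h ζ₀) r₂).uniformContinuousOn_of_continuous hΦc
  -- The tolerance ε r₁² is what the strict maximum loses at |ζ - ζ₀| = r₁.
  obtain ⟨η, hη, Hη⟩ := Metric.uniformContinuousOn_iff.1 hu (ε * r₁ ^ 2) (by positivity)
  set N : Set (Cn n × ℂ) := closedBall (h ζ₀) r₂ ×ˢ closedBall ζ₀ r₁ with hN
  have hNc : IsCompact N := (isCompact_closedBall _ _).prod (isCompact_closedBall _ _)
  have hne : N.Nonempty := ⟨(h ζ₀, ζ₀), by simp [hN, hr₁.le, hr₂.le]⟩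
  have hc1 : ContinuousOn (fun x : Cn n × ℂ => Φ x.1 + S x.2) N := fun x hx =>
    (((H2 hx.1).1.comp' continuousAt_fst).add
      ((H1 hx.2).1.1.comp' continuousAt_snd)).continuousWithinAt
  have hc2 : ∀ k : ℝ, ContinuousOn (fun x : Cn n × ℂ => Φ x.1 + S x.2 - k * ‖x.1 - h x.2‖ ^ 2) N :=
    fun k x hx => (hc1 x hx).sub (continuousAt_const.mul ((continuousAt_fst.sub
      ((H1 hx.2).1.2.1.comp' continuousAt_snd)).norm.pow 2)).continuousWithinAt
  obtain ⟨B, hB⟩ := (hNc.bddAbove_image hc1)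
  set J₀ := Φ (h ζ₀) + S ζ₀ with hJ
  set η' := min η (r₂ / 2) with hη'
  have hη'0 : 0 < η' := by positivity
  -- With this k, a point with |z - h(ζ)| ≥ η' pays more than B - J₀ and cannot be a maximizer.
  obtain ⟨k, hk⟩ : ∃ k : ℝ, |B - J₀| + 1 ≤ k * η' ^ 2 := ⟨(|B - J₀| + 1) / η' ^ 2, by
    rw [div_mul_cancel₀ _ (by positivity)]⟩
  have hk0 : 0 ≤ k := by
    by_contra hk'
    have := mul_nonpos_of_nonpos_of_nonneg (not_le.1 hk').le (sq_nonneg η')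
    linarith [abs_nonneg (B - J₀)]
  obtain ⟨⟨z, ζ⟩, hx, hxm⟩ := hNc.exists_isMaxOn hne (hc2 k)
  have hJle : J₀ ≤ Φ z + S ζ - k * ‖z - h ζ‖ ^ 2 := by
    have h3 := hxm (show (h ζ₀, ζ₀) ∈ N by simp [hN, hr₁.le, hr₂.le])
    simpa using h3
  have hBz : Φ z + S ζ ≤ B := hB ⟨(z, ζ), hx, rfl⟩
  have hclose : ‖z - h ζ‖ < η' := by
    by_contra hcon
    have h4 : k * η' ^ 2 ≤ k * ‖z - h ζ‖ ^ 2 := by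
      have := not_lt.1 hcon
      gcongr
    linarith [le_abs_self (B - J₀)]
  have hhζ : h ζ ∈ ball (h ζ₀) (r₂ / 2) := (H1 hx.2).2.2
  have hΦd : Φ z < Φ (h ζ) + ε * r₁ ^ 2 := by
    have := Hη z hx.1 (h ζ) (ball_subset_closedBall (ball_subset_ball (by linarith) hhζ))
      (by rw [dist_eq_norm]; exact hclose.trans_le (min_le_left _ _))
    rw [Real.dist_eq] at this
    linarith [(abs_lt.1 this).2]
  have hm := (H1 hx.2).2.1
  have hpos : 0 ≤ k * ‖z - h ζ‖ ^ 2 := by positivity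
  have hζin : ‖ζ - ζ₀‖ < r₁ := by
    by_contra hcon
    have : ε * r₁ ^ 2 ≤ ε * ‖ζ - ζ₀‖ ^ 2 := by
      have := not_lt.1 hcon
      gcongr
    linarith
  have hzin : z ∈ ball (h ζ₀) r₂ := by
    have h5 : dist z (h ζ) < r₂ / 2 := by
      rw [dist_eq_norm]; exact hclose.trans_le (min_le_right _ _)
    have h6 : dist (h ζ) (h ζ₀) < r₂ / 2 := hhζ
    exact mem_ball.2 ((dist_triangle z (h ζ) (h ζ₀)).trans_lt (by linarith))
  refine ⟨z, ζ, k, hk0, (H2 hx.1).2, (H1 hx.2).1.2.2, ?_⟩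
  refine hxm.isLocalMax ?_
  rw [hN, nhds_prod_eq]
  refine prod_mem_prod (mem_of_superset (isOpen_ball.mem_nhds hzin) ball_subset_closedBall) ?_
  exact mem_of_superset (isOpen_ball.mem_nhds (mem_ball.2 (by rwa [dist_eq_norm])))
    ball_subset_closedBall

/-- Maximum principle for the composition of a plurisubharmonic function with a holomorphic map. -/
lemma not_isLocalMax {Φ : Cn n → ℝ} {S : ℂ → ℝ} {h : ℂ → Cn n} {ζ₀ : ℂ} {ε : ℝ} (hε : 0 < ε)
    (hh : AnalyticAt ℂ h ζ₀) (hΦ : ∀ᶠ z in 𝓝 (h ζ₀), SubmeanAt 0 Φ z)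
    (hS : ∀ᶠ ζ in 𝓝 ζ₀, SubmeanAt ε S ζ) : ¬ IsLocalMax (fun ζ => Φ (h ζ) + S ζ) ζ₀ := by
  intro hmax
  -- Half of the gain ε is spent on making the maximum strict; the other half gives the
  -- contradiction.
  set S₁ : ℂ → ℝ := fun ζ => S ζ + (-(ε / 2)) * ‖ζ - ζ₀‖ ^ 2 with hS₁
  have hS1 : ∀ᶠ ζ in 𝓝 ζ₀, SubmeanAt (ε / 2) S₁ ζ := by
    filter_upwards [hS] with ζ hζ
    exact (hζ.add (submeanAt_normSq (-(ε / 2)) ζ₀ ζ)).mono (by linarith)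
  obtain ⟨z, ζ, k, hk, hz, ⟨hζ, hhζ⟩, hloc⟩ := exists_interior_max (Φ := Φ) (S := S₁) (half_pos hε)
    hh.continuousAt (P := SubmeanAt 0 Φ) (Q := fun ζ => SubmeanAt (ε / 2) S₁ ζ ∧ AnalyticAt ℂ h ζ)
    (hΦ.mono fun z hz => ⟨hz.1.self_of_nhds, hz⟩)
    (by filter_upwards [hS1, hh.eventually_analyticAt] with ζ h1 h2
          using ⟨h1.1.self_of_nhds, h2.continuousAt, h1, h2⟩)
    (by filter_upwards [hmax] with ζ h1
        simp only [hS₁, sub_self, norm_zero] at h1 ⊢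
        nlinarith)
  set X := deriv h ζ
  -- Along the affine disc (z + wX, ζ + w) with X = h'(ζ), the penalty is k|F(w)|² with F'(0) = 0.
  -- It therefore costs only o(r²) on average, against the gain (ε/2) r² of S₁.
  set F : ℂ → Cn n := fun w => z + w • X - h (ζ + w) with hFdef
  have hh' : AnalyticAt ℂ h (ζ + 0) := by simpa using hhζ
  have hF : AnalyticAt ℂ F 0 := by
    have h1 : AnalyticAt ℂ (fun w : ℂ => h (ζ + w)) 0 := hh'.fun_comp (by fun_prop)
    exact AnalyticAt.sub (by fun_prop) h1
  have hF0 : HasDerivAt F 0 0 := by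
    have h1 : HasDerivAt (fun w : ℂ => h (ζ + w)) X 0 := by
      have h2 : HasDerivAt h X (ζ + 0) := by rw [add_zero]; exact hhζ.differentiableAt.hasDerivAt
      simpa using h2.comp_const_add ζ 0
    have h2 : HasDerivAt (fun w : ℂ => z + w • X) X 0 := by
      simpa using ((hasDerivAt_id (0 : ℂ)).smul_const X).const_add z
    have h3 := h2.sub h1
    rw [sub_self] at h3
    exact h3
  have hε' : 0 < ε / (8 * (k + 1)) := by positivity
  have hev : ∀ᶠ w in 𝓝 (0 : ℂ), Φ (z + w • X) + S₁ (ζ + w • 1) - k * ‖F w‖ ^ 2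
      ≤ Φ z + S₁ ζ - k * ‖F 0‖ ^ 2 := by
    have hct : Tendsto (fun w : ℂ => (z + w • X, ζ + w • (1 : ℂ))) (𝓝 0) (𝓝 (z, ζ)) := by
      have : Continuous (fun w : ℂ => (z + w • X, ζ + w • (1 : ℂ))) := by fun_prop
      simpa using this.tendsto 0
    filter_upwards [hct.eventually hloc] with w hw
    simpa [hFdef] using hw
  obtain ⟨r, hr, h1, h2, h3, h4, h5⟩ := ((eventually_disc hev (1 : ℂ)).and
    ((circleAverage_normSq_le hF hF0 hε').and ((hz.2 X (ε / 8) (by positivity)).and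
      ((hζ.2 1 (ε / 8) (by positivity)).and ((eventually_circleIntegrable hz.1 X).and
        (eventually_circleIntegrable hζ.1 1)))))).exists
  have hint : CircleIntegrable (fun w => -k * ‖F w‖ ^ 2) 0 r := h1.1.const_mul (-k)
  have h6 : circleAverage (fun w => Φ (z + w • X) + S₁ (ζ + w • 1) + -k * ‖F w‖ ^ 2) 0 r
      ≤ Φ z + S₁ ζ - k * ‖F 0‖ ^ 2 := by
    refine circleAverage_mono_on_of_le_circle ((h4.add h5).add hint) fun w hw => ?_
    rw [abs_of_pos hr.1, mem_sphere_zero_iff_norm] at hw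
    have := hr.2 w hw.le
    simp only [zero_add, smul_eq_mul, mul_one] at this ⊢
    linarith
  have h7 : circleAverage (fun w => -k * ‖F w‖ ^ 2) 0 r
      = -k * circleAverage (fun w => ‖F w‖ ^ 2) 0 r := by
    simpa using circleAverage_fun_smul (f := fun w => ‖F w‖ ^ 2) (c := 0) (R := r) (a := -k)
  have h45 : CircleIntegrable (fun w => Φ (z + w • X) + S₁ (ζ + w • 1)) 0 r := h4.add h5
  rw [circleAverage_fun_add h45 hint, circleAverage_fun_add h4 h5, h7] at h6
  have h8 := mul_le_mul_of_nonneg_left h1.2 hk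
  have h9 : k * (ε / (8 * (k + 1))) ≤ ε / 8 := by
    rw [mul_div_assoc', div_le_div_iff₀ (by positivity) (by norm_num)]
    nlinarith
  have h10 : 0 < r ^ 2 := pow_pos hr.1 2
  have h11 := mul_le_mul_of_nonneg_right h9 h10.le
  simp only [norm_one, one_pow, mul_one, zero_mul, add_zero] at h3 h2
  nlinarith

/-- `Θ + log ‖· - p‖²` is plurisubharmonic on `Ω` with a logarithmic pole at `p`. -/
structure IsPolar (Ω : Set (Cn n)) (p : Cn n) (Θ : Cn n → ℝ) : Prop where
  cont : ContinuousOn Θ Ω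
  off : ∀ a ∈ Ω, a ≠ p → SubmeanAt 0 (fun z => Θ z + log (‖z - p‖ ^ 2)) a
  near : ∀ᶠ z in 𝓝 p, SubmeanAt 0 Θ z

/-- The function |q|² e^{Θ∘h}, with q the difference quotient of h at 0, is at most 4e^C on |ζ| =
1/2, where |q|² = 4|h-p|². The factor e^{ε|ζ|²} supplies the strict gain needed by `not_isLocalMax`.
-/
lemma IsPolar.sq_deriv_mul_exp_le {Ω : Set (Cn n)} {p : Cn n} {Θ : Cn n → ℝ} {C : ℝ}
    (hΘ : IsPolar Ω p Θ) (hC : ∀ z ∈ Ω, z ≠ p → Θ z + log (‖z - p‖ ^ 2) ≤ C)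
    (hΩ : IsOpen Ω) {h : ℂ → Cn n} (hd : DifferentiableOn ℂ h (ball 0 1))
    (hm : Set.MapsTo h (ball 0 1) Ω) (h0 : h 0 = p) :
    ‖deriv h 0‖ ^ 2 * exp (Θ p) ≤ 4 * exp C := by
  by_contra! hcon
  set q : ℂ → Cn n := dslope h 0 with hq
  have hb1 : ball (0 : ℂ) 1 ∈ 𝓝 (0 : ℂ) := ball_mem_nhds _ one_pos
  have hqd : DifferentiableOn ℂ q (ball 0 1) := (Complex.differentiableOn_dslope hb1).2 hd
  have hq0 : q 0 = deriv h 0 := dslope_same h 0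
  rw [← hq0] at hcon
  have hqne : ∀ ζ : ℂ, ζ ≠ 0 → ‖q ζ‖ ^ 2 = ‖h ζ - p‖ ^ 2 / ‖ζ‖ ^ 2 := by
    intro ζ hζ
    rw [hq, dslope_of_ne _ hζ, slope_def_module, sub_zero, h0, norm_smul, norm_inv]
    field_simp
  have hbn : ∀ ζ ∈ ball (0 : ℂ) 1, ball (0 : ℂ) 1 ∈ 𝓝 ζ := fun ζ hζ => isOpen_ball.mem_nhds hζ
  have hΘn : ∀ ζ ∈ ball (0 : ℂ) 1, ContinuousAt (fun ζ => Θ (h ζ)) ζ := fun ζ hζ =>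
    (hΘ.cont.continuousAt (hΩ.mem_nhds (hm hζ))).comp'
      (hd.continuousOn.continuousAt (hbn ζ hζ))
  obtain ⟨ε, hε, hεC⟩ : ∃ ε > 0, 4 * exp C * exp (ε * 1) < ‖q 0‖ ^ 2 * exp (Θ p) := by
    have h1 : Tendsto (fun ε : ℝ => 4 * exp C * exp (ε * 1)) (𝓝[>] 0) (𝓝 (4 * exp C)) := by
      have : Continuous (fun ε : ℝ => 4 * exp C * exp (ε * 1)) := by fun_prop
      simpa using (this.tendsto 0).mono_left nhdsWithin_le_nhds
    obtain ⟨ε, h2, h3⟩ := ((h1.eventually (gt_mem_nhds hcon)).and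
      self_mem_nhdsWithin).exists
    exact ⟨ε, h3, h2⟩
  have hq0ne : q 0 ≠ 0 := by
    intro h1
    have : 0 < 4 * exp C * exp (ε * 1) := by positivity
    simp only [h1, norm_zero] at hεC
    linarith
  set M : ℂ → ℝ := fun ζ => ‖q ζ‖ ^ 2 * exp (Θ (h ζ)) * exp (ε * ‖ζ‖ ^ 2) with hM
  have hsub : closedBall (0 : ℂ) (1 / 2) ⊆ ball 0 1 := closedBall_subset_ball (by norm_num)
  have hMc : ContinuousOn M (closedBall 0 (1 / 2)) := fun ζ hζ => by
    have h1 : ContinuousAt q ζ := hqd.continuousOn.continuousAt (hbn ζ (hsub hζ))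
    have h2 := hΘn ζ (hsub hζ)
    exact (((h1.norm.pow 2).mul h2.rexp).mul (by fun_prop)).continuousWithinAt
  obtain ⟨ζ₀, hζ₀, hmax⟩ := (isCompact_closedBall (0 : ℂ) (1 / 2)).exists_isMaxOn
    ⟨0, by simp⟩ hMc
  have hM0 : ‖q 0‖ ^ 2 * exp (Θ p) ≤ M ζ₀ := by
    have := hmax (show (0 : ℂ) ∈ closedBall 0 (1 / 2) by simp)
    simpa [hM, h0] using this
  have hMpos : 0 < M ζ₀ := lt_of_lt_of_le (by positivity) hM0
  have hqζ₀ : q ζ₀ ≠ 0 := fun h1 => by simp [hM, h1] at hMpos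
  have hζ₀b : ζ₀ ∈ ball (0 : ℂ) 1 := hsub hζ₀
  have hin : ‖ζ₀‖ < 1 / 2 := by
    by_contra h1
    have h2 : ‖ζ₀‖ = 1 / 2 := le_antisymm (mem_closedBall_zero_iff.1 hζ₀) (not_lt.1 h1)
    have h3 : ζ₀ ≠ 0 := by rw [← norm_pos_iff, h2]; norm_num
    have h4 := hqne ζ₀ h3
    have h5 : h ζ₀ ≠ p := by
      intro h6
      rw [h6] at h4
      simp [hqζ₀] at h4
    have h7 := exp_le_exp.2 (hC _ (hm hζ₀b) h5)
    rw [exp_add, exp_log (by have := sub_ne_zero.2 h5; positivity)] at h7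
    have h8 : M ζ₀ ≤ 4 * exp C * exp (ε * 1) := by
      simp only [hM]
      rw [h4, h2]
      have : exp (ε * (1 / 2) ^ 2) ≤ exp (ε * 1) := exp_le_exp.2 (by nlinarith)
      calc _ = 4 * (exp (Θ (h ζ₀)) * ‖h ζ₀ - p‖ ^ 2) * exp (ε * (1 / 2) ^ 2) := by ring
        _ ≤ _ := by gcongr
    linarith
  have hloc : ∀ᶠ ζ in 𝓝 ζ₀, q ζ ≠ 0 →
      log (‖q ζ‖ ^ 2) + Θ (h ζ) + ε * ‖ζ‖ ^ 2 ≤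
        log (‖q ζ₀‖ ^ 2) + Θ (h ζ₀) + ε * ‖ζ₀‖ ^ 2 := by
    filter_upwards [isOpen_ball.mem_nhds (mem_ball_zero_iff.2 hin)] with ζ hζ hqζ
    have h1 : M ζ ≤ M ζ₀ := hmax (ball_subset_closedBall hζ)
    have h2 : ∀ ζ, q ζ ≠ 0 → M ζ = exp (log (‖q ζ‖ ^ 2) + Θ (h ζ) + ε * ‖ζ‖ ^ 2) := by
      intro ζ h3
      rw [exp_add, exp_add, exp_log (by positivity)]
    rwa [h2 ζ hqζ, h2 ζ₀ hqζ₀, exp_le_exp] at h1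
  have hqa : AnalyticAt ℂ q ζ₀ := hqd.analyticAt (hbn ζ₀ hζ₀b)
  have hha : AnalyticAt ℂ h ζ₀ := hd.analyticAt (hbn ζ₀ hζ₀b)
  have hqev : ∀ᶠ ζ in 𝓝 ζ₀, q ζ ≠ 0 := hqa.continuousAt.eventually_ne hqζ₀
  -- At ζ₀ = 0 the disc meets the pole, so Θ alone is used and log|q|² is replaced by a harmonic
  -- minorant touching it. Elsewhere log|q|² splits as log|h-p|² - 2 log|ζ|.
  by_cases hz : ζ₀ = 0
  · set v := q 0
    have hg : AnalyticAt ℂ (fun ζ => inner ℂ v (q ζ)) ζ₀ := by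
      have : AnalyticAt ℂ (fun ζ => (innerSL ℂ v) (q ζ)) ζ₀ :=
        ((innerSL ℂ v).analyticAt _).fun_comp hqa
      simpa only [innerSL_apply_apply] using this
    have hv0 : inner ℂ v (q ζ₀) = ((‖v‖ ^ 2 : ℝ) : ℂ) := by
      rw [hz, inner_self_eq_norm_sq_to_K]; simp
    have hvn : 0 < ‖v‖ := norm_pos_iff.2 hq0ne
    have hgne : ∀ᶠ ζ in 𝓝 ζ₀, inner ℂ v (q ζ) ≠ 0 := hg.continuousAt.eventually_ne (by
      rw [hv0]; exact_mod_cast (by positivity))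
    refine not_isLocalMax (Φ := Θ) (S := fun ζ => 2 * log ‖inner ℂ v (q ζ)‖ + ε * ‖ζ - 0‖ ^ 2)
      hε hha (by rw [hz, h0]; exact hΘ.near) ?_ ?_
    · filter_upwards [hgne, hg.eventually_analyticAt] with ζ h1 h2
      simpa using (submeanAt_log_norm h2 h1 2).add (submeanAt_normSq ε 0 ζ)
    · filter_upwards [hloc, hqev, hgne] with ζ h1 h2 h3
      have h4 : ‖inner ℂ v (q ζ)‖ ≤ ‖v‖ * ‖q ζ‖ := norm_inner_le_norm _ _
      have h5 := log_le_log (norm_pos_iff.2 h3) h4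
      rw [log_mul hvn.ne' (norm_ne_zero_iff.2 h2)] at h5
      have h6 := h1 h2
      have h7 : log ‖inner ℂ v (q ζ₀)‖ = 2 * log ‖v‖ := by
        rw [hv0, Complex.norm_real, Real.norm_eq_abs, abs_of_pos (by positivity), log_pow]
        norm_num
      rw [log_pow, log_pow] at h6
      rw [h7, sub_zero, sub_zero]
      have h8 : q ζ₀ = v := by rw [hz]
      rw [h8] at h6
      push_cast at h6
      linarith
  · have hne : h ζ₀ ≠ p := by
      intro h1
      have := hqne ζ₀ hz
      rw [h1] at this
      simp [hqζ₀] at this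
    refine not_isLocalMax (Φ := fun z => Θ z + log (‖z - p‖ ^ 2))
      (S := fun ζ => -2 * log ‖ζ‖ + ε * ‖ζ - 0‖ ^ 2) hε hha ?_ ?_ ?_
    · filter_upwards [hΩ.mem_nhds (hm hζ₀b), isOpen_ne.mem_nhds hne] with z h1 h2
      exact hΘ.off z h1 h2
    · filter_upwards [isOpen_ne.mem_nhds hz] with ζ h1
      simpa using (submeanAt_log_norm (G := fun ζ : ℂ => ζ) analyticAt_id h1 (-2)).add
        (submeanAt_normSq ε 0 ζ)
    · have hall : ∀ ζ : ℂ, ζ ≠ 0 → h ζ ≠ p → log (‖q ζ‖ ^ 2)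
          = log (‖h ζ - p‖ ^ 2) + -2 * log ‖ζ‖ := by
        intro ζ h1 h2
        have h3 : ‖h ζ - p‖ ≠ 0 := norm_ne_zero_iff.2 (sub_ne_zero.2 h2)
        have h4 : ‖ζ‖ ≠ 0 := norm_ne_zero_iff.2 h1
        rw [hqne ζ h1, log_div (by positivity) (by positivity), log_pow ‖ζ‖]
        push_cast; ring
      filter_upwards [hloc, hqev, isOpen_ne.mem_nhds hz,
        hha.continuousAt.eventually_ne hne] with ζ h1 h2 h3 h4
      have h6 := h1 h2
      rw [hall ζ h3 h4, hall ζ₀ hz hne] at h6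
      simp only [sub_zero]
      linarith

end KobayashiBound

/-! ### Boundary distance and inward translation. -/

namespace KobayashiBound

open Filter Topology Metric Real

variable {n : ℕ} {Ω : Set (Cn n)}

lemma bdist_le_norm_sub {z y : Cn n} (hz : z ∈ Ω) (hy : y ∉ Ω) : bdist Ω z ≤ ‖y - z‖ := by
  obtain ⟨w, hw, h1⟩ := exists_mem_frontier_infDist_compl_eq_dist hz
    (fun h => hy (h ▸ Set.mem_univ y))
  calc bdist Ω z ≤ dist z w := infDist_le_dist_of_mem hw
    _ = infDist z Ωᶜ := h1.symm
    _ ≤ dist z y := infDist_le_dist_of_mem hy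
    _ = ‖y - z‖ := by rw [dist_comm, dist_eq_norm]

lemma bdist_pos (hΩ : IsOpen Ω) (hne : (frontier Ω).Nonempty) {z : Cn n} (hz : z ∈ Ω) :
    0 < bdist Ω z := by
  refine (isClosed_frontier.notMem_iff_infDist_pos hne).1 fun h => ?_
  rw [hΩ.frontier_eq] at h
  exact h.2 hz

lemma bdist_le_add (z w : Cn n) : bdist Ω z ≤ bdist Ω w + ‖z - w‖ := by
  rw [← dist_eq_norm]; exact infDist_le_infDist_add_dist

lemma continuous_bdist : Continuous (bdist Ω) := continuous_infDist_pt _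

/-- Near the boundary point `z₀`, translating by `-s • ν` pushes the points of the pseudoconvex open
set `Ω` into `Ω`, almost `s` further away from the boundary. -/
structure InwardShift (Ω : Set (Cn n)) (z₀ ν : Cn n) (ρ : ℝ) : Prop where
  isOpen : IsOpen Ω
  mem_frontier : z₀ ∈ frontier Ω
  norm_le : ‖ν‖ ≤ 1
  pos : 0 < ρ
  mem : ∀ z ∈ ball z₀ ρ, z ∈ Ω → ∀ s : ℝ, 0 ≤ s → s ≤ ρ → z - s • ν ∈ Ω
  le_bdist : ∀ z ∈ ball z₀ ρ, z ∈ Ω → ∀ s : ℝ, 0 ≤ s → s ≤ ρ →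
    19 / 20 * (s + bdist Ω z) ≤ bdist Ω (z - s • ν)
  submean : ∀ z ∈ Ω, SubmeanAt 0 (fun z => -log (bdist Ω z)) z

/-- Near z₀ the function -r is comparable to |dr(z₀)| times the distance, with ratio as close to 1
as desired. In a direction ν nearly maximizing dr(z₀), r is almost linear. The product of the
errors, (49/50)/(201/200), exceeds 19/20. -/
lemma exists_inwardShift (hΩ : Pseudoconvex Ω) {z₀ : Cn n} (hz₀ : z₀ ∈ frontier Ω)
    {U : Set (Cn n)} (hU : IsOpen U) (hzU : z₀ ∈ U) {r : Cn n → ℝ}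
    (hr : IsDefiningFunctionOn Ω U r) :
    ∃ ν : Cn n, ∃ ρ m : ℝ, 0 < m ∧ ball z₀ ρ ⊆ U ∧ InwardShift Ω z₀ ν ρ ∧
      ∀ z ∈ ball z₀ ρ, z ∈ Ω → -r z ≤ m * bdist Ω z := by
  obtain ⟨hr2, hrΩ, hr0⟩ := hr
  have hne : (frontier Ω).Nonempty := ⟨z₀, hz₀⟩
  have hz₀' : z₀ ∉ Ω := by rw [hΩ.1.frontier_eq] at hz₀; exact hz₀.2
  have hrz : r z₀ = 0 := by
    have hrc : ContinuousAt r z₀ := hr2.continuousOn.continuousAt (hU.mem_nhds hzU)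
    refine le_antisymm (not_lt.1 fun hpos => ?_) (not_lt.1 fun h => hz₀' ((hrΩ z₀ hzU).2 h))
    have h1 := (hrc.eventually (lt_mem_nhds hpos)).and (hU.mem_nhds hzU)
    obtain ⟨w, hw, hwΩ⟩ := mem_closure_iff_nhds.1 (frontier_subset_closure hz₀) _ h1
    exact (lt_asymm ((hrΩ w hw.2).1 hwΩ)) hw.1
  set L := fderiv ℝ r z₀ with hL
  set μ := ‖L‖ with hμ
  have hμ0 : 0 < μ := norm_pos_iff.2 (hr0 z₀ hzU hrz)
  obtain ⟨ν, hν1, hνL⟩ : ∃ ν : Cn n, ‖ν‖ < 1 ∧ 99 / 100 * μ < L ν := by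
    obtain ⟨x, hx, hx2⟩ := L.exists_lt_apply_of_lt_opNorm (r := 99 / 100 * μ) (by
      rw [← hμ]; linarith)
    rw [Real.norm_eq_abs] at hx2
    rcases abs_cases (L x) with h | h
    · exact ⟨x, hx, by linarith⟩
    · exact ⟨-x, by rwa [norm_neg], by rw [map_neg]; linarith⟩
  have hstrict : HasStrictFDerivAt r L z₀ :=
    (hr2.contDiffAt (hU.mem_nhds hzU)).hasStrictFDerivAt (by simp)
  have hev : ∀ᶠ x : Cn n × Cn n in 𝓝 (z₀, z₀),
      ‖r x.1 - r x.2 - L (x.1 - x.2)‖ ≤ μ / 200 * ‖x.1 - x.2‖ :=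
    hstrict.isLittleO.def (by positivity)
  have hev2 : ∀ᶠ x : Cn n × Cn n in 𝓝 (z₀, z₀), x.1 ∈ U ∧ x.2 ∈ U := by
    rw [nhds_prod_eq]; exact prod_mem_prod (hU.mem_nhds hzU) (hU.mem_nhds hzU)
  obtain ⟨ρ₁, hρ₁, H⟩ := Metric.eventually_nhds_iff_ball.1 (hev.and hev2)
  have HU : ∀ x ∈ ball z₀ ρ₁, x ∈ U := fun x hx => (H (x, x) (by rw [← ball_prod_same]; exact ⟨hx, hx⟩)).2.1
  have Hr : ∀ x ∈ ball z₀ ρ₁, ∀ y ∈ ball z₀ ρ₁, |r x - r y - L (x - y)| ≤ μ / 200 * ‖x - y‖ := by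
    intro x hx y hy
    exact (H (x, y) (by rw [← ball_prod_same]; exact ⟨hx, hy⟩)).1
  have Hup : ∀ x ∈ ball z₀ ρ₁, ∀ y ∈ ball z₀ ρ₁, r x - r y ≤ 201 / 200 * μ * ‖x - y‖ := by
    intro x hx y hy
    have h1 := (abs_le.1 (Hr x hx y hy)).2
    have h2 := (le_abs_self _).trans (L.le_opNorm (x - y))
    rw [← hμ] at h2
    linarith
  have Hlow : ∀ y ∈ ball z₀ ρ₁, ∀ s : ℝ, 0 ≤ s → y + s • ν ∈ ball z₀ ρ₁ →
      r y + 49 / 50 * μ * s ≤ r (y + s • ν) := by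
    intro y hy s hs hys
    have h1 := (abs_le.1 (Hr _ hys y hy)).1
    rw [add_sub_cancel_left, map_smul, norm_smul, Real.norm_eq_abs, abs_of_nonneg hs,
      smul_eq_mul] at h1
    have h2 : s * (99 / 100 * μ) ≤ s * L ν := by gcongr
    have h3 : μ / 200 * (s * ‖ν‖) ≤ μ / 200 * (s * 1) := by gcongr
    nlinarith
  have hdz : ∀ z, bdist Ω z ≤ ‖z - z₀‖ := fun z => by
    rw [← dist_eq_norm]; exact infDist_le_dist_of_mem hz₀
  have Hbd : ∀ z ∈ ball z₀ (ρ₁ / 2), z ∈ Ω → -r z ≤ 201 / 200 * μ * bdist Ω z := by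
    intro z hz hzΩ
    obtain ⟨w, hw, h1⟩ := isClosed_frontier.exists_infDist_eq_dist hne z
    have hzn : ‖z - z₀‖ < ρ₁ / 2 := by rwa [← dist_eq_norm]
    have h2 : dist z w ≤ ‖z - z₀‖ := h1 ▸ hdz z
    have hwb : w ∈ ball z₀ ρ₁ := by
      have := dist_triangle_left w z₀ z
      rw [mem_ball]; rw [mem_ball] at hz; linarith
    have hrw : 0 ≤ r w := by
      rw [hΩ.1.frontier_eq] at hw
      exact not_lt.1 fun h => hw.2 ((hrΩ w (HU w hwb)).2 h)
    have h3 := Hup w hwb z (ball_subset_ball (by linarith) hz)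
    rw [← dist_eq_norm, dist_comm, ← h1] at h3
    change r w - r z ≤ 201 / 200 * μ * bdist Ω z at h3
    linarith
  have hsn : ∀ z ∈ ball z₀ (ρ₁ / 8), ∀ s : ℝ, |s| ≤ ρ₁ / 4 → z + s • ν ∈ ball z₀ (ρ₁ / 2) := by
    intro z hz s hs
    have h1 : ‖s • ν‖ ≤ ρ₁ / 4 := by
      rw [norm_smul, Real.norm_eq_abs]
      nlinarith [abs_nonneg s, norm_nonneg ν]
    rw [mem_ball, dist_eq_norm] at hz ⊢
    have := norm_add_le (z - z₀) (s • ν)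
    rw [show z + s • ν - z₀ = z - z₀ + s • ν by abel]
    linarith
  have hin : ball z₀ (ρ₁ / 8) ⊆ ball z₀ ρ₁ := ball_subset_ball (by linarith)
  have hin2 : ball z₀ (ρ₁ / 2) ⊆ ball z₀ ρ₁ := ball_subset_ball (by linarith)
  have hsub : ∀ z ∈ ball z₀ (ρ₁ / 8), ∀ s : ℝ, 0 ≤ s → s ≤ ρ₁ / 8 →
      z - s • ν ∈ ball z₀ (ρ₁ / 2) := by
    intro z hz s hs hs2
    have := hsn z hz (-s) (by rw [abs_neg, abs_of_nonneg hs]; linarith)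
    rwa [neg_smul, ← sub_eq_add_neg] at this
  have hrsub : ∀ z ∈ ball z₀ (ρ₁ / 8), ∀ s : ℝ, 0 ≤ s → s ≤ ρ₁ / 8 →
      r (z - s • ν) + 49 / 50 * μ * s ≤ r z := by
    intro z hz s hs hs2
    have := Hlow (z - s • ν) (hin2 (hsub z hz s hs hs2)) s hs (by simpa using hin hz)
    simpa using this
  have hmem : ∀ z ∈ ball z₀ (ρ₁ / 8), z ∈ Ω → ∀ s : ℝ, 0 ≤ s → s ≤ ρ₁ / 8 → z - s • ν ∈ Ω := by
    intro z hz hzΩ s hs hs2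
    refine (hrΩ _ (HU _ (hin2 (hsub z hz s hs hs2)))).2 ?_
    have h1 := hrsub z hz s hs hs2
    have h2 := (hrΩ z (HU z (hin hz))).1 hzΩ
    have : 0 ≤ 49 / 50 * μ * s := by positivity
    linarith
  refine ⟨ν, ρ₁ / 8, 201 / 200 * μ, by positivity, fun z hz => HU z (hin hz),
    ⟨hΩ.1, hz₀, hν1.le, by positivity, hmem, ?_, ?_⟩,
    fun z hz hzΩ => Hbd z (ball_subset_ball (by linarith) hz) hzΩ⟩
  · intro z hz hzΩ s hs hs2
    have hrz0 : r z < 0 := (hrΩ z (HU z (hin hz))).1 hzΩ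
    have h1 := Hbd _ (hsub z hz s hs hs2) (hmem z hz hzΩ s hs hs2)
    have h2 := hrsub z hz s hs hs2
    have hzn : ‖z - z₀‖ < ρ₁ / 8 := by rwa [← dist_eq_norm]
    -- Moving outward by t reaches r ≥ 0, hence leaves Ω, so the distance from z to the boundary is
    -- at most t.
    have h3 : 49 / 50 * μ * bdist Ω z ≤ -r z := by
      set t := -r z / (49 / 50 * μ) with ht
      have ht0 : 0 ≤ t := div_nonneg (by linarith) (by positivity)
      have htm : 49 / 50 * μ * t = -r z := by rw [ht]; field_simp
      have ht1 : t ≤ ρ₁ / 4 := by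
        have h4 := Hbd z (ball_subset_ball (by linarith) hz) hzΩ
        have h5 : 201 / 200 * μ * bdist Ω z ≤ 201 / 200 * μ * (ρ₁ / 8) := by
          have := (hdz z).trans hzn.le
          gcongr
        rw [ht, div_le_iff₀ (by positivity)]
        nlinarith
      have hyb := hin2 (hsn z hz t (by rwa [abs_of_nonneg ht0]))
      have h6 := Hlow z (hin hz) t ht0 hyb
      have hy : z + t • ν ∉ Ω := fun h => by
        have := (hrΩ _ (HU _ hyb)).1 h
        linarith
      have h7 := bdist_le_norm_sub hzΩ hy
      rw [add_sub_cancel_left, norm_smul, Real.norm_eq_abs, abs_of_nonneg ht0] at h7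
      have h8 : bdist Ω z ≤ t := h7.trans (mul_le_of_le_one_right ht0 hν1.le)
      calc _ ≤ 49 / 50 * μ * t := by gcongr
        _ = _ := htm
    have h9 : 49 / 50 * μ * (s + bdist Ω z) ≤ 201 / 200 * μ * bdist Ω (z - s • ν) := by linarith
    have h10 : 49 / 50 * (s + bdist Ω z) ≤ 201 / 200 * bdist Ω (z - s • ν) := by
      refine le_of_mul_le_mul_left ?_ hμ0
      linarith
    have h11 : 0 ≤ bdist Ω z := infDist_nonneg
    linarith
  · intro z hz
    refine submeanAt_of_PSHOn hΩ.1 (fun w hw => ?_) hΩ.2 hz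
    exact (continuous_bdist.continuousAt.log (bdist_pos hΩ.1 hne hw).ne').neg.continuousWithinAt

namespace InwardShift

variable {z₀ ν : Cn n} {ρ : ℝ}

lemma bdist_pos (hS : InwardShift Ω z₀ ν ρ) {z : Cn n} (hz : z ∈ Ω) : 0 < bdist Ω z :=
  KobayashiBound.bdist_pos hS.isOpen ⟨z₀, hS.mem_frontier⟩ hz

lemma bdist_sub_le (hS : InwardShift Ω z₀ ν ρ) (z : Cn n) {s : ℝ} (hs : 0 ≤ s) :
    bdist Ω (z - s • ν) ≤ s + bdist Ω z := by
  have h1 := bdist_le_add (Ω := Ω) (z - s • ν) z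
  have h2 : ‖s • ν‖ ≤ s := by
    rw [norm_smul, Real.norm_eq_abs, abs_of_nonneg hs]
    exact mul_le_of_le_one_right hs hS.norm_le
  rw [sub_sub_cancel_left, norm_neg] at h1
  linarith

end InwardShift

/-- The function `-log (δ_Ω(z - σν) / σ)`, bounded near the boundary and plurisubharmonic. -/
noncomputable def layer (Ω : Set (Cn n)) (ν : Cn n) (σ : ℝ) (z : Cn n) : ℝ := -log (bdist Ω (z - σ • ν) / σ)

namespace InwardShift

variable {z₀ ν : Cn n} {ρ σ : ℝ}

lemma le_layer (hS : InwardShift Ω z₀ ν ρ) (hσ : 0 < σ) (hσρ : σ ≤ ρ) {z : Cn n}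
    (hz : z ∈ ball z₀ ρ) (hzΩ : z ∈ Ω) : -log (1 + bdist Ω z / σ) ≤ layer Ω ν σ z := by
  have h1 := hS.bdist_pos (hS.mem z hz hzΩ σ hσ.le hσρ)
  refine neg_le_neg (log_le_log (by positivity) ?_)
  rw [div_le_iff₀ hσ, add_mul, one_mul, div_mul_cancel₀ _ hσ.ne']
  exact hS.bdist_sub_le z hσ.le

lemma layer_le (hS : InwardShift Ω z₀ ν ρ) (hσ : 0 < σ) (hσρ : σ ≤ ρ) {z : Cn n}
    (hz : z ∈ ball z₀ ρ) (hzΩ : z ∈ Ω) :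
    layer Ω ν σ z ≤ -log (1 + bdist Ω z / σ) + log (20 / 19) := by
  have h2 := hS.bdist_pos hzΩ
  have h1 : 0 < 1 + bdist Ω z / σ := by positivity
  rw [neg_add_eq_sub, ← log_div (by norm_num) h1.ne', layer, ← log_inv]
  have h3 := hS.bdist_pos (hS.mem z hz hzΩ σ hσ.le hσρ)
  refine log_le_log (by positivity) ?_
  have h4 := hS.le_bdist z hz hzΩ σ hσ.le hσρ
  rw [inv_div, div_le_div_iff₀ h3 h1]
  have h5 : σ * (1 + bdist Ω z / σ) = σ + bdist Ω z := by field_simp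
  linarith

lemma submeanAt_layer (hS : InwardShift Ω z₀ ν ρ) (hσ : 0 < σ) (hσρ : σ ≤ ρ) {z : Cn n}
    (hz : z ∈ ball z₀ ρ) (hzΩ : z ∈ Ω) : SubmeanAt 0 (layer Ω ν σ) z := by
  have h1 := hS.mem z hz hzΩ σ hσ.le hσρ
  have h2 := hS.submean _ h1
  rw [sub_eq_add_neg] at h2
  have h3 := h2.comp_add_right.add_const (log σ)
  refine h3.congr ?_
  have hev : ∀ᶠ w in 𝓝 z, w - σ • ν ∈ Ω :=
    (continuous_id.sub continuous_const).continuousAt.preimage_mem_nhds (hS.isOpen.mem_nhds h1)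
  filter_upwards [hev] with w hw
  rw [layer, log_div (hS.bdist_pos hw).ne' hσ.ne', sub_eq_add_neg w]
  ring

end InwardShift

end KobayashiBound

/-! ### Widening a strip. -/

namespace KobayashiBound

open Filter Topology Metric Real

variable {n : ℕ} {Ω : Set (Cn n)} {z₀ ν : Cn n} {ρ δ K : ℝ}

/-- There is a plurisubharmonic function with values in `[-1, 0]` near `z₀` in `Ω` whose Levi form is
at least `K` where the distance to the boundary is less than `δ`. -/
def HasStrip (Ω : Set (Cn n)) (z₀ : Cn n) (ρ δ K : ℝ) : Prop :=
  ∃ u : Cn n → ℝ, ∀ z ∈ ball z₀ (ρ - 2 * δ), z ∈ Ω →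
    -1 ≤ u z ∧ u z ≤ 0 ∧ SubmeanAt 0 u z ∧ (bdist Ω z < δ → SubmeanAt K u z)

/-- The slope used to glue a strip to its translate. -/
noncomputable def glueSlope : ℝ := 2 / log (11 / 10)

/-- The factor by which the Levi form drops when a strip is widened by `5 / 4`. -/
noncomputable def widenLoss : ℝ := (2 + glueSlope * log (32 / 19))⁻¹

lemma glueSlope_pos : 0 < glueSlope := div_pos two_pos (log_pos (by norm_num))

lemma widenLoss_pos : 0 < widenLoss := by
  have h1 := glueSlope_pos
  have h2 : 0 < log (32 / 19) := log_pos (by norm_num)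
  unfold widenLoss; positivity

lemma widenLoss_le : widenLoss ≤ 1 / 2 := by
  have h1 := glueSlope_pos
  have h2 : 0 < log (32 / 19) := log_pos (by norm_num)
  rw [widenLoss, one_div]
  refine inv_anti₀ two_pos ?_
  nlinarith [mul_pos h1 h2]

/-- The translate u(z + (δ/2)ν) has its large Levi form farther inside. It is glued by a maximum to
u + `lam`, where `lam` falls from at least 1 to at most -1 across the overlap, so the oscillation of
u cannot spoil the gluing. -/
lemma HasStrip.widen (hS : InwardShift Ω z₀ ν ρ) (hδ : 0 < δ)
    (h : HasStrip Ω z₀ ρ δ K) : HasStrip Ω z₀ ρ (5 / 4 * δ) (widenLoss * K) := by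
  obtain ⟨u, hu⟩ := h
  set N := glueSlope with hN
  have hN0 : 0 < N := glueSlope_pos
  have hNlog : N * log (11 / 10) = 2 := by
    have : log (11 / 10) ≠ 0 := (log_pos (by norm_num)).ne'
    rw [hN, glueSlope, div_mul_cancel₀ _ this]
  set lam : Cn n → ℝ := fun z => N * (layer Ω ν δ z + log (8 / 5)) + 1 with hlam
  set A : Cn n → ℝ := fun z => u z + lam z with hA
  set B : Cn n → ℝ := fun z => u (z + (δ / 2) • ν) with hB
  set w : Cn n → ℝ := fun z => if bdist Ω z ≤ δ / 2 then A z else max (A z) (B z) with hw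
  set G : Set (Cn n) := ball z₀ (ρ - 2 * (5 / 4 * δ)) ∩ Ω with hG
  have hGo : IsOpen G := isOpen_ball.inter hS.isOpen
  have hzb : ∀ z ∈ G, z ∈ ball z₀ (ρ - 2 * δ) := fun z hz =>
    ball_subset_ball (by linarith) hz.1
  have hzρ : ∀ z ∈ G, z ∈ ball z₀ ρ := fun z hz => ball_subset_ball (by linarith) hz.1
  have hδρ : ∀ z ∈ G, δ ≤ ρ := fun z hz => by
    have := pos_of_mem_ball hz.1
    linarith
  have hs : ‖(δ / 2) • ν‖ ≤ δ / 2 := by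
    rw [norm_smul, Real.norm_eq_abs, abs_of_pos (by positivity)]
    exact mul_le_of_le_one_right (by positivity) hS.norm_le
  -- The radius ρ - 2δ drops by δ/2 when δ becomes 5δ/4, which is exactly the length allowed for the
  -- translation.
  have hsh : ∀ z ∈ G, z + (δ / 2) • ν ∈ ball z₀ (ρ - 2 * δ) := fun z hz => by
    have h1 := hz.1
    rw [mem_ball, dist_eq_norm] at h1 ⊢
    have := norm_add_le (z - z₀) ((δ / 2) • ν)
    rw [show z + (δ / 2) • ν - z₀ = z - z₀ + (δ / 2) • ν by abel]
    linarith
  have hshΩ : ∀ z ∈ G, δ / 2 < bdist Ω z → z + (δ / 2) • ν ∈ Ω := fun z hz hd => by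
    by_contra hcon
    have := bdist_le_norm_sub hz.2 hcon
    rw [add_sub_cancel_left] at this
    linarith
  have hlow : ∀ z ∈ G, bdist Ω z ≤ 3 / 5 * δ → 1 ≤ lam z := fun z hz hd => by
    have h1 := hS.le_layer hδ (hδρ z hz) (hzρ z hz) hz.2
    have h2 : log (1 + bdist Ω z / δ) ≤ log (8 / 5) := by
      have h4 := hS.bdist_pos hz.2
      refine log_le_log (by positivity) ?_
      have : bdist Ω z / δ ≤ 3 / 5 := (div_le_iff₀ hδ).2 hd
      linarith
    have h3 : 0 ≤ N * (layer Ω ν δ z + log (8 / 5)) := mul_nonneg hN0.le (by linarith)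
    simp only [hlam]
    linarith
  have hhigh : ∀ z ∈ G, 19 / 20 * δ ≤ bdist Ω z → lam z ≤ -1 := fun z hz hd => by
    have h1 := hS.layer_le hδ (hδρ z hz) (hzρ z hz) hz.2
    have h2 : log (39 / 20) ≤ log (1 + bdist Ω z / δ) := by
      refine log_le_log (by norm_num) ?_
      have : 19 / 20 ≤ bdist Ω z / δ := (le_div_iff₀ hδ).2 hd
      linarith
    -- Here 20/19 is the error of `layer`, 8/5 its value at distance 3δ/5, and 11/10 the remaining
    -- room, which `glueSlope` turns into a drop of 2.
    have h3 : log (20 / 19) + log (8 / 5) + log (11 / 10) ≤ log (39 / 20) := by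
      rw [← log_mul (by norm_num) (by norm_num), ← log_mul (by norm_num) (by norm_num)]
      exact log_le_log (by norm_num) (by norm_num)
    have h4 : N * (layer Ω ν δ z + log (8 / 5)) ≤ N * (-log (11 / 10)) := by
      gcongr; linarith
    simp only [hlam]
    linarith
  have hup : ∀ z ∈ G, lam z ≤ N * log (32 / 19) + 1 := fun z hz => by
    have h1 := hS.layer_le hδ (hδρ z hz) (hzρ z hz) hz.2
    have h2 : 0 ≤ log (1 + bdist Ω z / δ) := by
      have := hS.bdist_pos hz.2
      exact log_nonneg (by have : 0 ≤ bdist Ω z / δ := by positivity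
                           linarith)
    have h3 : log (20 / 19) + log (8 / 5) = log (32 / 19) := by
      rw [← log_mul (by norm_num) (by norm_num)]; norm_num
    have h4 : N * (layer Ω ν δ z + log (8 / 5)) ≤ N * log (32 / 19) := by
      gcongr; linarith
    simp only [hlam]
    linarith
  have hlamS : ∀ z ∈ G, SubmeanAt 0 lam z := fun z hz => by
    have h1 := hS.submeanAt_layer hδ (hδρ z hz) (hzρ z hz) hz.2
    simpa [hlam] using ((h1.add_const (log (8 / 5))).const_mul hN0.le).add_const 1
  have hdc : ∀ z, ContinuousAt (bdist Ω) z := fun z => continuous_bdist.continuousAt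
  have hBrange : ∀ z ∈ G, δ / 2 < bdist Ω z → -1 ≤ B z ∧ B z ≤ 0 := fun z hz hd =>
    ⟨(hu _ (hsh z hz) (hshΩ z hz hd)).1, (hu _ (hsh z hz) (hshΩ z hz hd)).2.1⟩
  have hwS : ∀ z ∈ G, ∀ K' : ℝ, (bdist Ω z < δ → SubmeanAt K' u z) →
      (δ / 2 < bdist Ω z → SubmeanAt K' u (z + (δ / 2) • ν)) → SubmeanAt K' w z := by
    intro z hz K' h1 h2
    have hAS : bdist Ω z < δ → SubmeanAt K' A z := fun hd => by
      simpa using (h1 hd).add (hlamS z hz)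
    have hBS : δ / 2 < bdist Ω z → SubmeanAt K' B z := fun hd => (h2 hd).comp_add_right
    rcases lt_or_ge (bdist Ω z) (3 / 5 * δ) with hd | hd
    · refine (hAS (by linarith)).congr ?_
      filter_upwards [hGo.mem_nhds hz, (hdc z).eventually (gt_mem_nhds hd)] with y hy hyd
      simp only [hw]
      split_ifs with hif
      · rfl
      · have h3 := hlow y hy hyd.le
        have h4 := hBrange y hy (not_le.1 hif)
        have h5 := hu y (hzb y hy) hy.2
        rw [max_eq_left]
        simp only [hA]
        linarith
    · have hd2 : δ / 2 < bdist Ω z := by linarith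
      rcases lt_or_ge (bdist Ω z) δ with hd3 | hd3
      · refine ((hAS hd3).max (hBS hd2)).congr ?_
        filter_upwards [(hdc z).eventually (lt_mem_nhds hd2)] with y hyd
        simp only [hw]
        rw [if_neg (not_le.2 hyd)]
      · refine (hBS hd2).congr ?_
        have hd4 : 19 / 20 * δ < bdist Ω z := by linarith
        filter_upwards [hGo.mem_nhds hz, (hdc z).eventually (lt_mem_nhds hd4)] with y hy hyd
        have h3 := hhigh y hy hyd.le
        have h4 := hBrange y hy (by linarith)
        have h5 := hu y (hzb y hy) hy.2
        simp only [hw]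
        rw [if_neg (not_le.2 (by linarith)), max_eq_right]
        simp only [hA]
        linarith
  -- The glued function ranges in [-1, C]; normalizing it to [-1, 0] costs the factor 1/(1 + C),
  -- which is `widenLoss`.
  set C := N * log (32 / 19) + 1 with hC
  have hCβ : widenLoss = (1 + C)⁻¹ := by rw [widenLoss, hC]; congr 1; ring
  have hC0 : 0 < C := by
    have : 0 < log (32 / 19) := log_pos (by norm_num)
    positivity
  have hwr : ∀ z ∈ G, -1 ≤ w z ∧ w z ≤ C := by
    intro z hz
    have h1 := hu z (hzb z hz) hz.2
    have h2 := hup z hz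
    simp only [hw]
    split_ifs with hif
    · have h3 := hlow z hz (by linarith)
      simp only [hA]
      constructor <;> linarith
    · have h4 := hBrange z hz (not_le.1 hif)
      refine ⟨le_max_of_le_right h4.1, max_le ?_ ?_⟩
      · simp only [hA]; linarith
      · linarith
  refine ⟨fun z => widenLoss * w z + -(widenLoss * C), fun z hz hzΩ => ?_⟩
  have hzG : z ∈ G := ⟨hz, hzΩ⟩
  have hβ := widenLoss_pos
  have hβC : widenLoss * (1 + C) = 1 := by rw [hCβ, inv_mul_cancel₀ (by positivity)]
  refine ⟨?_, ?_, ?_, fun hd => ?_⟩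
  · have := mul_le_mul_of_nonneg_left (hwr z hzG).1 hβ.le
    linarith
  · have := mul_le_mul_of_nonneg_left (hwr z hzG).2 hβ.le
    linarith
  · have h1 : SubmeanAt 0 w z := hwS z hzG 0 (fun _ => (hu z (hzb z hzG) hzΩ).2.2.1)
      (fun hd => (hu _ (hsh z hzG) (hshΩ z hzG hd)).2.2.1)
    simpa using (h1.const_mul hβ.le).add_const (-(widenLoss * C))
  · have h1 : SubmeanAt K w z := hwS z hzG K (fun h => (hu z (hzb z hzG) hzΩ).2.2.2 h) (fun hd2 => by
      refine (hu _ (hsh z hzG) (hshΩ z hzG hd2)).2.2.2 ?_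
      -- The shifted point has distance less than (5/4 · 20/19 - 1/2)δ < δ, so it lies in the old
      -- strip.
      have h2 := hS.le_bdist (z + (δ / 2) • ν) (ball_subset_ball (by linarith) (hsh z hzG))
        (hshΩ z hzG hd2) (δ / 2) (by positivity) (by have := hδρ z hzG; linarith)
      rw [add_sub_cancel_right] at h2
      linarith)
    exact (h1.const_mul hβ.le).add_const _

end KobayashiBound

/-! ### Functions with a logarithmic pole at a fixed scale. -/

namespace KobayashiBound

open Filter Topology Metric Real

variable {n : ℕ} {Ω : Set (Cn n)} {z₀ ν p : Cn n} {ρ δ K : ℝ}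

lemma IsPolar.of_submeanAt {Θ : Cn n → ℝ}
    (hoff : ∀ a ∈ Ω, a ≠ p → SubmeanAt 0 (fun z => Θ z + log (‖z - p‖ ^ 2)) a)
    (hnear : ∀ᶠ z in 𝓝 p, SubmeanAt 0 Θ z) : IsPolar Ω p Θ := by
  refine ⟨fun a ha => ContinuousAt.continuousWithinAt ?_, hoff, hnear⟩
  by_cases h : a = p
  · rw [h]; exact hnear.self_of_nhds.1.self_of_nhds
  · have h1 := (hoff a ha h).1.self_of_nhds
    have h2 := (submeanAt_log_dist h).1.self_of_nhds
    refine (h1.sub h2).congr (Eventually.of_forall fun z => ?_)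
    simp

lemma IsPolar.add_const {Θ : Cn n → ℝ} (h : IsPolar Ω p Θ) (c : ℝ) :
    IsPolar Ω p (fun z => Θ z + c) := by
  refine .of_submeanAt (fun a ha hap => ?_) (h.near.mono fun z hz => hz.add_const c)
  simpa only [add_right_comm] using (h.off a ha hap).add_const c

lemma SubmeanAt.add_log {Θ : Cn n → ℝ} {a : Cn n} (h : SubmeanAt 0 Θ a) (ha : a ≠ p) :
    SubmeanAt 0 (fun z => Θ z + log (‖z - p‖ ^ 2)) a := by
  simpa using h.add (submeanAt_log_dist ha)

/-- The building block of the gluings, plurisubharmonic where the Levi form of `u` is at least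
`K`. -/
lemma submeanAt_block (hS : InwardShift Ω z₀ ν ρ) (hδ : 0 < δ) (hδρ : δ ≤ ρ) {u : Cn n → ℝ}
    {z : Cn n} (hz : z ∈ ball z₀ ρ) (hzΩ : z ∈ Ω) (hu : SubmeanAt K u z) {N : ℝ} (hN : 0 ≤ N)
    (p : Cn n) : SubmeanAt 0 (fun z => u z - K * ‖z - p‖ ^ 2 + N * layer Ω ν δ z) z := by
  have h1 := (hu.add (submeanAt_normSq (-K) p z)).add
    ((hS.submeanAt_layer hδ hδρ hz hzΩ).const_mul hN)
  refine (h1.mono (by simp)).congr (Eventually.of_forall fun w => ?_)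
  ring

lemma mem_ball_of_sq_lt {m : ℝ} (hK : 0 < K) (hm : m ≤ K * (ρ / 4) ^ 2) (hρ : 0 < ρ)
    (hδ : 8 * δ ≤ ρ) (hp : p ∈ ball z₀ (ρ / 4)) {z : Cn n} (hz : K * ‖z - p‖ ^ 2 < m) :
    z ∈ ball z₀ (ρ - 2 * δ) := by
  have h1 : ‖z - p‖ < ρ / 4 := by
    have : ‖z - p‖ ^ 2 < (ρ / 4) ^ 2 := lt_of_mul_lt_mul_left (hz.trans_le hm) hK.le
    exact lt_of_pow_lt_pow_left₀ 2 (by positivity) this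
  have h2 := dist_triangle z p z₀
  rw [mem_ball] at hp ⊢
  rw [dist_eq_norm z p] at h2
  linarith

/-- The slope of `layer` in the localization at a fixed scale. -/
noncomputable def baseSlope : ℝ := 4 / log (9 / 5)

/-- The size of `K ‖z - p‖²` at the lateral edge in the localization at a fixed scale. -/
noncomputable def baseWidth : ℝ := 2 * (4 + baseSlope * log (20 / 19))

lemma baseSlope_pos : 0 < baseSlope := div_pos (by norm_num) (log_pos (by norm_num))

lemma baseWidth_ge : 8 ≤ baseWidth := by
  have h1 := baseSlope_pos
  have h2 : 0 < log (20 / 19) := log_pos (by norm_num)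
  have := mul_pos h1 h2
  unfold baseWidth; linarith

/-- Global plurisubharmonic functions with a logarithmic pole at `p`, uniformly in `p` near `z₀`. -/
lemma exists_isPolar (hS : InwardShift Ω z₀ ν ρ) (hδ : 0 < δ) (hδρ : 8 * δ ≤ ρ) (hK : 0 < K)
    (hKρ : baseWidth ≤ K * (ρ / 4) ^ 2) (h : HasStrip Ω z₀ ρ δ K) :
    ∃ ρ' > 0, ∃ T : ℝ, ∀ p ∈ ball z₀ ρ', p ∈ Ω → ∃ Θ : Cn n → ℝ, IsPolar Ω p Θ ∧
      (∀ z ∈ Ω, ‖z - p‖ < ρ' → 0 ≤ Θ z) ∧ ∀ z ∈ Ω, z ≠ p → Θ z + log (‖z - p‖ ^ 2) ≤ T := by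
  obtain ⟨u, hu⟩ := h
  have hρ := hS.pos
  set N := baseSlope with hN
  have hN0 : 0 < N := baseSlope_pos
  have hNlog : N * log (9 / 5) = 4 := by
    rw [hN, baseSlope, div_mul_cancel₀ _ (log_pos (by norm_num)).ne']
  set m := baseWidth with hm
  have hm8 : 8 ≤ m := baseWidth_ge
  have hmN : m = 2 * (4 + N * log (20 / 19)) := rfl
  have hl20 : 0 < log (20 / 19) := log_pos (by norm_num)
  obtain ⟨ρ', ⟨⟨h1ρ, h2ρ⟩, h3ρ⟩, hρ'⟩ : ∃ ρ' : ℝ, ((K * ρ' ^ 2 ≤ 1 / 2 ∧ N * (2 * ρ' / δ) ≤ 1 / 2) ∧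
      ρ' ≤ δ / 4) ∧ 0 < ρ' := by
    have e1 : Tendsto (fun x : ℝ => K * x ^ 2) (𝓝[>] 0) (𝓝 0) := by
      have : Continuous (fun x : ℝ => K * x ^ 2) := by fun_prop
      simpa using (this.tendsto 0).mono_left nhdsWithin_le_nhds
    have e2 : Tendsto (fun x : ℝ => N * (2 * x / δ)) (𝓝[>] 0) (𝓝 0) := by
      have : Continuous (fun x : ℝ => N * (2 * x / δ)) := by fun_prop
      simpa using (this.tendsto 0).mono_left nhdsWithin_le_nhds
    have e3 : ∀ᶠ x : ℝ in 𝓝[>] 0, x ≤ δ / 4 := by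
      filter_upwards [Ioo_mem_nhdsGT (show 0 < δ / 4 by positivity)] with x hx using hx.2.le
    exact ((((e1.eventually (ge_mem_nhds (by norm_num))).and
      (e2.eventually (ge_mem_nhds (by norm_num)))).and e3).and self_mem_nhdsWithin).exists
  -- The factor T makes F ≥ G for ρ'/2 < |z-p| < ρ', where w ≥ -1, while w ≤ -3 at the edge of D
  -- gives F ≤ G there. The constant Q below then makes Θ nonnegative near p.
  set T := |log (K * ρ' ^ 2 / (4 * m))| with hT
  have hT0 : 0 ≤ T := abs_nonneg _
  set Q := T - log (K / m) with hQ
  refine ⟨ρ', hρ', max (T * (1 + N * log (20 / 19)) + Q) (-2 * T + Q), fun p hp hpΩ => ?_⟩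
  have hp4 : p ∈ ball z₀ (ρ / 4) := ball_subset_ball (by linarith) hp
  set w : Cn n → ℝ := fun z => (u z - K * ‖z - p‖ ^ 2 + N * layer Ω ν δ z) + 1 with hw
  set F : Cn n → ℝ := fun z => T * w z + log (K / m) with hF
  set G : Cn n → ℝ := fun z => -2 * T - log (‖z - p‖ ^ 2) with hG
  set D : Set (Cn n) := {z | bdist Ω z < δ ∧ K * ‖z - p‖ ^ 2 < m} with hD
  set D₀ : Set (Cn n) := {z | bdist Ω z ≤ 9 / 10 * δ ∧ K * ‖z - p‖ ^ 2 ≤ m / 2} with hD₀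
  have hqc : Continuous (fun z : Cn n => K * ‖z - p‖ ^ 2) := by fun_prop
  have hDo : IsOpen D := (isOpen_lt continuous_bdist continuous_const).inter
    (isOpen_lt hqc continuous_const)
  have hD₀c : IsClosed D₀ := (isClosed_le continuous_bdist continuous_const).inter
    (isClosed_le hqc continuous_const)
  have hD₀D : D₀ ⊆ D := fun z hz => ⟨by have := hz.1; linarith, by have := hz.2; linarith⟩
  have hDb : ∀ z ∈ D, z ∈ ball z₀ (ρ - 2 * δ) := fun z hz =>
    mem_ball_of_sq_lt hK hKρ hρ hδρ hp4 hz.2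
  have hDb' : ∀ z ∈ D, z ∈ ball z₀ ρ := fun z hz => ball_subset_ball (by linarith) (hDb z hz)
  have hsmall : ∀ z, ‖z - p‖ < ρ' → bdist Ω z ≤ 2 * ρ' := fun z hz => by
    have h1 := bdist_le_add (Ω := Ω) z p
    have h2 : bdist Ω p ≤ dist p z₀ := infDist_le_dist_of_mem hS.mem_frontier
    have h3 := mem_ball.1 hp
    linarith
  have hsD : ∀ z, ‖z - p‖ < ρ' → z ∈ D₀ := fun z hz => by
    refine ⟨by have := hsmall z hz; linarith, ?_⟩
    have : K * ‖z - p‖ ^ 2 ≤ K * ρ' ^ 2 := by gcongr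
    linarith
  have hwS : ∀ z ∈ D, z ∈ Ω → SubmeanAt 0 w z := fun z hz hzΩ =>
    (submeanAt_block hS hδ (by linarith) (hDb' z hz) hzΩ
      ((hu z (hDb z hz) hzΩ).2.2.2 hz.1) hN0.le p).add_const 1
  have hFS : ∀ z ∈ D, z ∈ Ω → SubmeanAt 0 F z := fun z hz hzΩ => by
    simpa using ((hwS z hz hzΩ).const_mul hT0).add_const (log (K / m))
  have hxpos : ∀ z ∈ Ω, 0 < bdist Ω z / δ := fun z hz => div_pos (hS.bdist_pos hz) hδ
  have hwlow : ∀ z ∈ Ω, ‖z - p‖ < ρ' → -1 ≤ w z := fun z hzΩ hz => by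
    have hzD := hD₀D (hsD z hz)
    have h1 := (hu z (hDb z hzD) hzΩ).1
    have h2 : K * ‖z - p‖ ^ 2 ≤ K * ρ' ^ 2 := by gcongr
    have h3 := hS.le_layer hδ (by linarith) (hDb' z hzD) hzΩ
    have h4 : log (1 + bdist Ω z / δ) ≤ 2 * ρ' / δ := by
      have h5 := log_le_sub_one_of_pos (show 0 < 1 + bdist Ω z / δ by linarith [hxpos z hzΩ])
      have h6 : bdist Ω z / δ ≤ 2 * ρ' / δ := by have := hsmall z hz; gcongr
      linarith
    have h7 : N * (-(2 * ρ' / δ)) ≤ N * layer Ω ν δ z := by gcongr; linarith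
    simp only [hw]
    linarith
  have hwup : ∀ z ∈ D, z ∈ Ω → w z ≤ 1 + N * log (20 / 19) - K * ‖z - p‖ ^ 2
      - N * log (1 + bdist Ω z / δ) := fun z hz hzΩ => by
    have h1 := (hu z (hDb z hz) hzΩ).2.1
    have h2 := mul_le_mul_of_nonneg_left
      (hS.layer_le hδ (by linarith) (hDb' z hz) hzΩ) hN0.le
    simp only [hw]
    linarith
  have hlogx : ∀ z ∈ Ω, 0 ≤ N * log (1 + bdist Ω z / δ) := fun z hz =>
    mul_nonneg hN0.le (log_nonneg (by linarith [hxpos z hz]))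
  have hedge : ∀ z ∈ D, z ∈ Ω → z ∉ D₀ → w z ≤ -3 := fun z hz hzΩ hzD => by
    have h1 := hwup z hz hzΩ
    have h2 := hlogx z hzΩ
    rcases lt_or_ge (9 / 10 * δ) (bdist Ω z) with h3 | h3
    · have h4 : log (20 / 19) + log (9 / 5) ≤ log (1 + bdist Ω z / δ) := by
        rw [← log_mul (by norm_num) (by norm_num)]
        refine log_le_log (by norm_num) ?_
        have : 9 / 10 ≤ bdist Ω z / δ := (le_div_iff₀ hδ).2 h3.le
        linarith
      have h5 := mul_le_mul_of_nonneg_left h4 hN0.le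
      have : 0 ≤ K * ‖z - p‖ ^ 2 := by positivity
      linarith
    · have h4 : m / 2 < K * ‖z - p‖ ^ 2 := not_le.1 fun h => hzD ⟨h3, h⟩
      linarith
  have hlogD : ∀ z ∈ D, z ≠ p → log (K / m) + log (‖z - p‖ ^ 2) ≤ 0 := fun z hz hzp => by
    have h1 : 0 < ‖z - p‖ := norm_pos_iff.2 (sub_ne_zero.2 hzp)
    rw [← log_mul (by positivity) (by positivity)]
    refine log_nonpos (by positivity) ?_
    rw [div_mul_eq_mul_div, div_le_one (by linarith)]
    exact hz.2.le
  have hFG : ∀ z ∈ Ω, ρ' / 2 < ‖z - p‖ → ‖z - p‖ < ρ' → G z ≤ F z := fun z hzΩ hz1 hz2 => by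
    have h1 := mul_le_mul_of_nonneg_left (hwlow z hzΩ hz2) hT0
    have h2 : log (K * ρ' ^ 2 / (4 * m)) ≤ log (K / m) + log (‖z - p‖ ^ 2) := by
      have : 0 < ‖z - p‖ := by linarith
      rw [← log_mul (by positivity) (by positivity)]
      refine log_le_log (by positivity) ?_
      have h3 : (ρ' / 2) ^ 2 ≤ ‖z - p‖ ^ 2 := by gcongr
      calc K * ρ' ^ 2 / (4 * m) = K / m * (ρ' / 2) ^ 2 := by field_simp; ring
        _ ≤ _ := by gcongr
    have h4 := neg_abs_le (log (K * ρ' ^ 2 / (4 * m)))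
    simp only [hF, hG]
    linarith
  have hGF : ∀ z ∈ D, z ∈ Ω → z ∉ D₀ → z ≠ p → F z ≤ G z := fun z hz hzΩ hzD hzp => by
    have h1 := mul_le_mul_of_nonneg_left (hedge z hz hzΩ hzD) hT0
    have h2 := hlogD z hz hzp
    simp only [hF, hG]
    linarith
  classical
  set Θ : Cn n → ℝ := fun z => if ‖z - p‖ < ρ' then F z else if z ∈ D then max (F z) (G z)
    else G z with hΘ
  have hcore : ∀ a ∈ Ω, ‖a - p‖ < ρ' → SubmeanAt 0 Θ a := fun a ha hap => by
    refine (hFS a (hD₀D (hsD a hap)) ha).congr ?_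
    have hc : ContinuousAt (fun z : Cn n => ‖z - p‖) a := by fun_prop
    filter_upwards [hc.eventually (gt_mem_nhds hap)] with z hz
    simp only [hΘ]; rw [if_pos hz]
  have hGlog : ∀ z, G z + log (‖z - p‖ ^ 2) = -2 * T := fun z => by simp only [hG]; ring
  have hpol : IsPolar Ω p Θ := by
    refine .of_submeanAt (fun a ha hap => ?_) ?_
    · have hc : ContinuousAt (fun z : Cn n => ‖z - p‖) a := by fun_prop
      rcases lt_or_ge ‖a - p‖ ρ' with h1 | h1
      · exact (hcore a ha h1).add_log hap
      · have h2 : ∀ᶠ z in 𝓝 a, ρ' / 2 < ‖z - p‖ := hc.eventually (lt_mem_nhds (by linarith))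
        by_cases haD : a ∈ D
        · have h3 : SubmeanAt 0 (fun z => max (F z + log (‖z - p‖ ^ 2)) (-2 * T)) a :=
            ((hFS a haD ha).add_log hap).max (submeanAt_const _ _)
          refine h3.congr ?_
          filter_upwards [h2, hDo.mem_nhds haD, hS.isOpen.mem_nhds ha] with z hz1 hz2 hz3
          simp only [hΘ]
          split_ifs with hif
          · have := hFG z hz3 hz1 hif
            rw [← hGlog z, max_add_add_right, max_eq_left this]
          · rw [← hGlog z, max_add_add_right]
        · refine (submeanAt_const (-2 * T) a).congr ?_
          have haD₀ : a ∉ D₀ := fun h => haD (hD₀D h)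
          filter_upwards [hD₀c.isOpen_compl.mem_nhds haD₀, hS.isOpen.mem_nhds ha,
            isOpen_ne.mem_nhds hap] with z hz1 hz2 hz3
          simp only [hΘ]
          rw [if_neg (fun h => hz1 (hsD z h))]
          split_ifs with hif
          · rw [max_eq_right (hGF z hif hz2 hz1 hz3), hGlog]
          · rw [hGlog]
    · filter_upwards [hS.isOpen.mem_nhds hpΩ, ball_mem_nhds p hρ'] with z hz1 hz2
      exact hcore z hz1 (by rwa [mem_ball, dist_eq_norm] at hz2)
  have hupF : ∀ z ∈ D, z ∈ Ω → z ≠ p →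
      F z + log (‖z - p‖ ^ 2) ≤ T * (1 + N * log (20 / 19)) := fun z hz hzΩ hzp => by
    have h1 := hwup z hz hzΩ
    have h2 := hlogx z hzΩ
    have h3 := hlogD z hz hzp
    have h4 : 0 ≤ K * ‖z - p‖ ^ 2 := by positivity
    have h5 : T * w z ≤ T * (1 + N * log (20 / 19)) := by gcongr; linarith
    simp only [hF]
    linarith
  have hΘup : ∀ z ∈ Ω, z ≠ p → Θ z + log (‖z - p‖ ^ 2)
      ≤ max (T * (1 + N * log (20 / 19))) (-2 * T) := fun z hzΩ hzp => by
    simp only [hΘ]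
    split_ifs with h1 h2
    · exact le_max_of_le_left (hupF z (hD₀D (hsD z h1)) hzΩ hzp)
    · rw [← max_add_add_right, hGlog]
      exact max_le_max_right _ (hupF z h2 hzΩ hzp)
    · rw [hGlog]; exact le_max_right _ _
  refine ⟨fun z => Θ z + Q, hpol.add_const Q, fun z hzΩ hz => ?_, fun z hzΩ hzp => ?_⟩
  · have h1 := mul_le_mul_of_nonneg_left (hwlow z hzΩ hz) hT0
    simp only [hΘ]
    rw [if_pos hz]
    simp only [hF, hQ]
    linarith
  · have := hΘup z hzΩ hzp
    rw [max_add_add_right]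
    linarith

end KobayashiBound

/-! ### Chaining the scales. -/

namespace KobayashiBound

open Filter Topology Metric Real

variable {n : ℕ} {Ω : Set (Cn n)} {z₀ ν p : Cn n} {ρ δ K : ℝ}

/-- The slope of `layer` in the gluing of consecutive scales. -/
noncomputable def chainSlope : ℝ := (1 - log widenLoss) / log (26 / 25)

/-- The size of `K ‖z - p‖²` at the lateral edge in the gluing of consecutive scales. -/
noncomputable def chainWidth : ℝ := 4 * (1 - log widenLoss + chainSlope * log (20 / 19))

lemma log_widenLoss_neg : log widenLoss < 0 :=
  log_neg widenLoss_pos (widenLoss_le.trans_lt (by norm_num))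

lemma chainSlope_pos : 0 < chainSlope :=
  div_pos (by linarith [log_widenLoss_neg]) (log_pos (by norm_num))

lemma chainWidth_pos : 0 < chainWidth := by
  have h2 : 0 < log (20 / 19) := log_pos (by norm_num)
  have := mul_pos chainSlope_pos h2
  unfold chainWidth; linarith [log_widenLoss_neg]

/-- A plurisubharmonic function bounded by `C` with a logarithmic pole at `p`, with a lower bound
at the scale `δ`. -/
def HasPolar (Ω : Set (Cn n)) (p : Cn n) (C δ K : ℝ) : Prop :=
  ∃ Θ : Cn n → ℝ, IsPolar Ω p Θ ∧ (∀ z ∈ Ω, z ≠ p → Θ z + log (‖z - p‖ ^ 2) ≤ C) ∧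
    ∀ z ∈ Ω, bdist Ω z < δ → K * ‖z - p‖ ^ 2 < chainWidth →
      log K - K * ‖z - p‖ ^ 2 - 1 - chainSlope * log (1 + bdist Ω z / δ) ≤ Θ z

/-- The new Θ is the maximum of the local block and the old Θ, which dominates the block near the
edges of D. The lower bound at the new scale comes from the block, and the common upper bound is
preserved. -/
lemma HasPolar.step (hS : InwardShift Ω z₀ ν ρ) (hδ : 0 < δ) (hδρ : 8 * δ ≤ ρ) (hK : 0 < K)
    (hKρ : chainWidth ≤ K * (ρ / 4) ^ 2) (hp : p ∈ ball z₀ (ρ / 4)) (hpΩ : p ∈ Ω)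
    (hstrip : HasStrip Ω z₀ ρ δ K) {C : ℝ} (hC : -1 + chainSlope * log (20 / 19) ≤ C)
    (h : HasPolar Ω p C (5 / 4 * δ) (widenLoss * K)) : HasPolar Ω p C δ K := by
  obtain ⟨u, hu⟩ := hstrip
  obtain ⟨Θ, hΘ, hΘC, hΘlow⟩ := h
  have hρ := hS.pos
  set N := chainSlope with hN
  have hN0 : 0 < N := chainSlope_pos
  set β := widenLoss with hβ
  have hβ0 : 0 < β := widenLoss_pos
  have hβ1 : β ≤ 1 / 2 := widenLoss_le
  have hlβ : log β < 0 := log_widenLoss_neg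
  have hNlog : N * log (26 / 25) = 1 - log β := by
    rw [hN, chainSlope, div_mul_cancel₀ _ (log_pos (by norm_num)).ne']
  set m := chainWidth with hm
  have hm0 : 0 < m := chainWidth_pos
  have hmN : m = 4 * (1 - log β + N * log (20 / 19)) := rfl
  have hl20 : 0 < log (20 / 19) := log_pos (by norm_num)
  set F : Cn n → ℝ := fun z => (u z - K * ‖z - p‖ ^ 2 + N * layer Ω ν δ z) + log K with hF
  set D : Set (Cn n) := {z | bdist Ω z < δ ∧ K * ‖z - p‖ ^ 2 < m} with hD
  set D₀ : Set (Cn n) := {z | bdist Ω z ≤ 9 / 10 * δ ∧ K * ‖z - p‖ ^ 2 ≤ m / 2} with hD₀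
  have hqc : Continuous (fun z : Cn n => K * ‖z - p‖ ^ 2) := by fun_prop
  have hDo : IsOpen D := (isOpen_lt continuous_bdist continuous_const).inter
    (isOpen_lt hqc continuous_const)
  have hD₀c : IsClosed D₀ := (isClosed_le continuous_bdist continuous_const).inter
    (isClosed_le hqc continuous_const)
  have hD₀D : D₀ ⊆ D := fun z hz => ⟨by have := hz.1; linarith, by have := hz.2; linarith⟩
  have hDb : ∀ z ∈ D, z ∈ ball z₀ (ρ - 2 * δ) := fun z hz =>
    mem_ball_of_sq_lt hK hKρ hρ hδρ hp hz.2
  have hDb' : ∀ z ∈ D, z ∈ ball z₀ ρ := fun z hz => ball_subset_ball (by linarith) (hDb z hz)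
  have hFS : ∀ z ∈ D, z ∈ Ω → SubmeanAt 0 F z := fun z hz hzΩ =>
    (submeanAt_block hS hδ (by linarith) (hDb' z hz) hzΩ
      ((hu z (hDb z hz) hzΩ).2.2.2 hz.1) hN0.le p).add_const _
  have hxpos : ∀ z ∈ Ω, 0 < bdist Ω z / δ := fun z hz => div_pos (hS.bdist_pos hz) hδ
  have hFup : ∀ z ∈ D, z ∈ Ω → F z ≤ log K - K * ‖z - p‖ ^ 2 + N * log (20 / 19)
      - N * log (1 + bdist Ω z / δ) := fun z hz hzΩ => by
    have h1 := (hu z (hDb z hz) hzΩ).2.1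
    have h2 := mul_le_mul_of_nonneg_left
      (hS.layer_le hδ (by linarith) (hDb' z hz) hzΩ) hN0.le
    simp only [hF]
    linarith
  have hFlow : ∀ z ∈ D, z ∈ Ω → log K - K * ‖z - p‖ ^ 2 - 1
      - N * log (1 + bdist Ω z / δ) ≤ F z := fun z hz hzΩ => by
    have h1 := (hu z (hDb z hz) hzΩ).1
    have h2 := mul_le_mul_of_nonneg_left
      (hS.le_layer hδ (by linarith) (hDb' z hz) hzΩ) hN0.le
    simp only [hF]
    linarith
  -- With s = K|z-p|², the bound log s - s ≤ -1 removes all dependence on K.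
  have hFC : ∀ z ∈ D, z ∈ Ω → z ≠ p → F z + log (‖z - p‖ ^ 2) ≤ C := fun z hz hzΩ hzp => by
    have h1 := hFup z hz hzΩ
    have h2 : 0 ≤ N * log (1 + bdist Ω z / δ) :=
      mul_nonneg hN0.le (log_nonneg (by linarith [hxpos z hzΩ]))
    have h3 : 0 < ‖z - p‖ := norm_pos_iff.2 (sub_ne_zero.2 hzp)
    have h4 := log_le_sub_one_of_pos (show 0 < K * ‖z - p‖ ^ 2 by positivity)
    rw [log_mul hK.ne' (by positivity)] at h4
    linarith
  -- The old Θ may lie lower by 1 - log β plus the error of `layer`. At the inner edge this is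
  -- recovered from (1+x)/(1+4x/5) ≥ (20/19)(26/25) for x ≥ 9/10, and at the lateral edge from
  -- (1-β)K|z-p|² ≥ m/4.
  have hedge : ∀ z ∈ D, z ∈ Ω → z ∉ D₀ → F z ≤ Θ z := fun z hz hzΩ hzD => by
    have ht : 0 ≤ K * ‖z - p‖ ^ 2 := by positivity
    have h1 := hΘlow z hzΩ (by linarith [hz.1]) (by
      rw [mul_assoc]
      calc β * (K * ‖z - p‖ ^ 2) ≤ 1 * (K * ‖z - p‖ ^ 2) := by gcongr; linarith
        _ < m := by rw [one_mul]; exact hz.2)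
    have h2 := hFup z hz hzΩ
    rw [log_mul hβ0.ne' hK.ne', mul_assoc] at h1
    set x := bdist Ω z / δ with hx
    have hx0 : 0 < x := hxpos z hzΩ
    have hx' : bdist Ω z / (5 / 4 * δ) = 4 / 5 * x := by rw [hx]; field_simp
    rw [hx'] at h1
    have h3 : β * (K * ‖z - p‖ ^ 2) ≤ 1 / 2 * (K * ‖z - p‖ ^ 2) := by gcongr
    rcases lt_or_ge (9 / 10 * δ) (bdist Ω z) with h4 | h4
    · have h5 : 9 / 10 ≤ x := (le_div_iff₀ hδ).2 h4.le
      have h6 : log (1 + 4 / 5 * x) + log (20 / 19) + log (26 / 25) ≤ log (1 + x) := by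
        rw [← log_mul (by positivity) (by norm_num), ← log_mul (by positivity) (by norm_num)]
        exact log_le_log (by positivity) (by linarith)
      have h7 := mul_le_mul_of_nonneg_left h6 hN0.le
      linarith
    · have h5 : m / 2 < K * ‖z - p‖ ^ 2 := not_le.1 fun h => hzD ⟨h4, h⟩
      have h6 : log (1 + 4 / 5 * x) ≤ log (1 + x) := log_le_log (by positivity) (by linarith)
      have h7 := mul_le_mul_of_nonneg_left h6 hN0.le
      linarith
  classical
  set Θ' : Cn n → ℝ := fun z => if z ∈ D then max (F z) (Θ z) else Θ z with hΘ'
  have hev₀ : ∀ a ∈ Ω, a ∉ D → ∀ᶠ z in 𝓝 a, Θ z = Θ' z := fun a ha haD => by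
    filter_upwards [hD₀c.isOpen_compl.mem_nhds (fun h => haD (hD₀D h)),
      hS.isOpen.mem_nhds ha] with z hz1 hz2
    simp only [hΘ']
    split_ifs with hif
    · rw [max_eq_right (hedge z hif hz2 hz1)]
    · rfl
  refine ⟨Θ', .of_submeanAt (fun a ha hap => ?_) ?_, fun z hzΩ hzp => ?_, fun z hzΩ hz1 hz2 => ?_⟩
  · by_cases haD : a ∈ D
    · refine (((hFS a haD ha).add_log hap).max (hΘ.off a ha hap)).congr ?_
      filter_upwards [hDo.mem_nhds haD] with z hz
      simp only [hΘ']
      rw [if_pos hz, max_add_add_right]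
    · refine (hΘ.off a ha hap).congr ?_
      filter_upwards [hev₀ a ha haD] with z hz
      rw [hz]
  · by_cases hpD : p ∈ D
    · filter_upwards [hΘ.near, hDo.mem_nhds hpD, hS.isOpen.mem_nhds hpΩ] with z hz1 hz2 hz3
      refine ((hFS z hz2 hz3).max hz1).congr ?_
      filter_upwards [hDo.mem_nhds hz2] with y hy
      simp only [hΘ']
      rw [if_pos hy]
    · filter_upwards [hΘ.near, eventually_eventually_nhds.2 (hev₀ p hpΩ hpD)] with z hz1 hz2
      exact hz1.congr hz2
  · simp only [hΘ']
    split_ifs with hif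
    · rw [← max_add_add_right]
      exact max_le (hFC z hif hzΩ hzp) (hΘC z hzΩ hzp)
    · exact hΘC z hzΩ hzp
  · have hzD : z ∈ D := ⟨hz1, hz2⟩
    simp only [hΘ']
    rw [if_pos hzD]
    exact le_max_of_le_left (hFlow z hzD hzΩ)

/-- Induction on the number of widenings that bring K below Kmin. The chain stops one step earlier,
at Kmin ≤ K < Kmin/β, where the lower bound on the fixed-scale Θ already exceeds log K. -/
lemma HasPolar.of_hasStrip (hS : InwardShift Ω z₀ ν ρ) {Kmin A ρ' C : ℝ} (hKmin : 0 < Kmin)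
    (hρK : chainWidth ≤ Kmin * (ρ / 4) ^ 2) (hρ' : 0 < ρ') (hρ'K : chainWidth ≤ Kmin * ρ' ^ 2)
    (hA : 8 * A ≤ ρ * Kmin) (hC : -1 + chainSlope * log (20 / 19) ≤ C)
    (hp : p ∈ ball z₀ (ρ / 4)) (hpΩ : p ∈ Ω) {Θ : Cn n → ℝ} (hΘ : IsPolar Ω p Θ)
    (hΘC : ∀ z ∈ Ω, z ≠ p → Θ z + log (‖z - p‖ ^ 2) ≤ C)
    (hΘlow : ∀ z ∈ Ω, ‖z - p‖ < ρ' → log (Kmin / widenLoss) ≤ Θ z) (k : ℕ) :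
    ∀ δ K : ℝ, 0 < δ → Kmin ≤ K → widenLoss ^ k * K < Kmin → K * δ ≤ A →
      HasStrip Ω z₀ ρ δ K → HasPolar Ω p C δ K := by
  have hβ0 : 0 < widenLoss := widenLoss_pos
  induction k with
  | zero => intro δ K hδ h1 h2; simp only [pow_zero, one_mul] at h2; linarith
  | succ k ih =>
    intro δ K hδ h1 h2 h3 hstrip
    have hK : 0 < K := hKmin.trans_le h1
    rcases lt_or_ge (widenLoss * K) Kmin with h4 | h4
    · refine ⟨Θ, hΘ, hΘC, fun z hzΩ hz1 hz2 => ?_⟩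
      have h5 : ‖z - p‖ < ρ' := by
        have h6 : Kmin * ‖z - p‖ ^ 2 < Kmin * ρ' ^ 2 := by
          calc Kmin * ‖z - p‖ ^ 2 ≤ K * ‖z - p‖ ^ 2 := by gcongr
            _ < _ := hz2.trans_le hρ'K
        exact lt_of_pow_lt_pow_left₀ 2 hρ'.le (lt_of_mul_lt_mul_left h6 hKmin.le)
      have h6 : log K ≤ log (Kmin / widenLoss) :=
        log_le_log hK ((le_div_iff₀ hβ0).2 (by linarith))
      have h7 : 0 ≤ chainSlope * log (1 + bdist Ω z / δ) := by
        have h8 : 0 < bdist Ω z / δ := div_pos (hS.bdist_pos hzΩ) hδ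
        exact mul_nonneg chainSlope_pos.le (log_nonneg (by linarith))
      have h8 : 0 ≤ K * ‖z - p‖ ^ 2 := by positivity
      linarith [hΘlow z hzΩ h5]
    -- Bounded Kδ together with K ≥ Kmin keeps the strip thin compared with ρ.
    · have h8δ : 8 * δ ≤ ρ := by
        have h5 : Kmin * δ ≤ K * δ := by gcongr
        refine le_of_mul_le_mul_left ?_ hKmin
        linarith
      refine HasPolar.step hS hδ h8δ hK (hρK.trans (by gcongr)) hp hpΩ hstrip hC ?_
      refine ih _ _ (by positivity) h4 (by rwa [← mul_assoc, ← pow_succ]) ?_ (hstrip.widen hS hδ)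
      have h5 : widenLoss * (K * δ) ≤ 1 / 2 * (K * δ) := by
        have := widenLoss_le
        gcongr
      have h6 : 0 < K * δ := by positivity
      linarith

lemma HasStrip.widen_iterate (hS : InwardShift Ω z₀ ν ρ) (hδ : 0 < δ)
    (h : HasStrip Ω z₀ ρ δ K) (j : ℕ) :
    HasStrip Ω z₀ ρ ((5 / 4) ^ j * δ) (widenLoss ^ j * K) := by
  induction j with
  | zero => simpa using h
  | succ j ih =>
    have := ih.widen hS (by positivity)
    rwa [← mul_assoc, ← mul_assoc, ← pow_succ', ← pow_succ'] at this

/-! ### The rate functions f and g. -/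

section Rate

variable {f : ℝ → ℝ}

/-- If f were bounded by B, then 1/a ≤ B/(a f(a)) would be integrable at infinity. -/
lemma IsRate.exists_le (hf : IsRate f) {t₀ : ℝ} (ht₀ : 1 < t₀)
    (hint : MeasureTheory.IntegrableOn (fun a : ℝ => 1 / (a * f a)) (Set.Ioi t₀)) (B : ℝ) :
    ∃ t₁ : ℝ, 1 ≤ t₁ ∧ ∀ t, t₁ ≤ t → B ≤ f t := by
  by_contra! hcon
  have hB : ∀ a, 1 ≤ a → f a ≤ B := fun a ha => by
    obtain ⟨t, hat, ht⟩ := hcon a ha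
    exact (hf.2.1 ha (ha.trans hat) hat).trans ht.le
  refine not_integrableOn_Ioi_inv (a := t₀) ?_
  refine (hint.const_mul B).mono' (by fun_prop) ?_
  refine (MeasureTheory.ae_restrict_iff' measurableSet_Ioi).2 (Eventually.of_forall fun a ha => ?_)
  have ha1 : 1 ≤ a := ht₀.le.trans (le_of_lt ha)
  have ha0 : 0 < a := by linarith
  have hf1 := (hf.2.2 a ha1).1
  have hfa := hB a ha1
  rw [Real.norm_eq_abs, abs_of_pos (inv_pos.2 ha0), mul_one_div, inv_eq_one_div,
    div_le_div_iff₀ ha0 (by positivity)]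
  nlinarith

/-- On [t, et] the integrand is at least 1/(a f(et)), and ∫ da/a = 1 there. -/
lemma IsRate.rateG_le (hf : IsRate f) {t₀ t : ℝ} (ht₀ : 1 < t₀)
    (hint : MeasureTheory.IntegrableOn (fun a : ℝ => 1 / (a * f a)) (Set.Ioi t₀)) (ht : t₀ ≤ t) :
    rateG f t ≤ f (exp 1 * t) := by
  have ht1 : 1 ≤ t := ht₀.le.trans ht
  have ht0 : 0 < t := by linarith
  have hle : t ≤ exp 1 * t := le_mul_of_one_le_left ht0.le (one_le_exp zero_le_one)
  have hf1 := (hf.2.2 _ (ht1.trans hle)).1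
  have hfpos : 0 < f (exp 1 * t) := by linarith
  rw [rateG]
  refine inv_le_of_inv_le₀ hfpos ?_
  have hint' := hint.mono_set (Set.Ioi_subset_Ioi ht)
  have hpos : ∀ a, a ∈ Set.Ioi t → 0 ≤ 1 / (a * f a) := fun a ha => by
    have ha1 : 1 ≤ a := ht1.trans (le_of_lt ha)
    have := (hf.2.2 a ha1).1
    positivity
  have h1 : ∫ a in Set.Ioc t (exp 1 * t), 1 / (a * f a) ≤ ∫ a in Set.Ioi t, 1 / (a * f a) :=
    MeasureTheory.setIntegral_mono_set hint'
      ((MeasureTheory.ae_restrict_iff' measurableSet_Ioi).2 (Eventually.of_forall hpos))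
      Set.Ioc_subset_Ioi_self.eventuallyLE
  refine le_trans ?_ h1
  have h2 : ∫ a in Set.Ioc t (exp 1 * t), a⁻¹ * (f (exp 1 * t))⁻¹ = (f (exp 1 * t))⁻¹ := by
    rw [MeasureTheory.integral_mul_const, ← intervalIntegral.integral_of_le hle,
      integral_inv_of_pos ht0 (by positivity), mul_div_cancel_right₀ _ ht0.ne', log_exp, one_mul]
  rw [← h2]
  refine MeasureTheory.setIntegral_mono_on ?_ (hint'.mono_set Set.Ioc_subset_Ioi_self)
    measurableSet_Ioc fun a ha => ?_
  · have : IntervalIntegrable (fun a : ℝ => a⁻¹ * (f (exp 1 * t))⁻¹) MeasureTheory.volume t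
        (exp 1 * t) := by
      refine (intervalIntegral.intervalIntegrable_inv (f := fun a : ℝ => a) (fun a ha => ?_)
        continuousOn_id).mul_const _
      rw [Set.uIcc_of_le hle] at ha
      linarith [ha.1]
    exact (intervalIntegrable_iff_integrableOn_Ioc_of_le hle).1 this
  · have ha1 : 1 ≤ a := ht1.trans ha.1.le
    have ha0 : 0 < a := by linarith
    have hfa := (hf.2.2 a ha1).1
    have hmono := hf.2.1 ha1 (ht1.trans hle) ha.2
    rw [← mul_inv, inv_eq_one_div]
    gcongr

end Rate

/-! ### Derivative bound for discs and the Kobayashi metric. -/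

lemma HasStrip.of_fProperty {U : Set (Cn n)} (hΩ : IsOpen Ω) (hU : IsOpen U)
    (hρU : ball z₀ ρ ⊆ U) {r φ : Cn n → ℝ} {m : ℝ} (hrU : ∀ z ∈ U, z ∈ Ω ↔ r z < 0)
    (hr : ∀ z ∈ ball z₀ ρ, z ∈ Ω → -r z ≤ m * bdist Ω z) (hm : 0 < m) (hδ : 0 < δ)
    (hφ : ContDiffOn ℝ 2 φ (U ∩ Ω)) (hφ1 : PSHOn φ (U ∩ Ω))
    (hφ2 : ∀ z ∈ U ∩ Ω, -1 ≤ φ z ∧ φ z ≤ 0)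
    (hφ3 : ∀ z ∈ U ∩ Ω, -(m * δ) < r z → r z < 0 → ∀ X, K * ‖X‖ ^ 2 ≤ leviForm φ z X) :
    HasStrip Ω z₀ ρ δ K := by
  refine ⟨φ, fun z hz hzΩ => ?_⟩
  have hzρ : z ∈ ball z₀ ρ := ball_subset_ball (by linarith) hz
  have hzU : z ∈ U ∩ Ω := ⟨hρU hzρ, hzΩ⟩
  have ho : IsOpen (U ∩ Ω) := hU.inter hΩ
  refine ⟨(hφ2 z hzU).1, (hφ2 z hzU).2, submeanAt_of_PSHOn ho hφ.continuousOn hφ1 hzU,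
    fun hd => ?_⟩
  refine submeanAt_of_leviForm (hφ.contDiffAt (ho.mem_nhds hzU)) (hφ3 z hzU ?_ ?_)
  · have h1 := hr z hzρ hzΩ
    have h2 : m * bdist Ω z < m * δ := by gcongr
    linarith
  · exact (hrU z hzU.1).1 hzΩ

/-- Bound for the derivatives of the analytic discs in `Ω` with centre near `z₀`. -/
lemma exists_deriv_bound (hΩ : Pseudoconvex Ω) (hz₀ : z₀ ∈ frontier Ω) {f : ℝ → ℝ}
    (hf : IsRate f) (hinf : ∀ B : ℝ, ∃ t₁ : ℝ, 1 ≤ t₁ ∧ ∀ t, t₁ ≤ t → B ≤ f t)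
    (hF : FProperty Ω z₀ f) :
    ∃ ρ > 0, ∃ M : ℝ, 0 < M ∧ ∀ p ∈ ball z₀ ρ, p ∈ Ω → ∀ h : ℂ → Cn n,
      DifferentiableOn ℂ h (ball 0 1) → Set.MapsTo h (ball 0 1) Ω → h 0 = p →
        ‖deriv h 0‖ * f (exp 1 * (bdist Ω p)⁻¹) ≤ M := by
  obtain ⟨U, hU, hzU, r, hr, φ, c, C₀, hc, -, hφ⟩ := hF
  obtain ⟨ν, ρ, m, hm, hρU, hS, hrm⟩ := exists_inwardShift hΩ hz₀ hU hzU hr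
  have hρ := hS.pos
  have hstrip : ∀ t : ℝ, 1 ≤ t → HasStrip Ω z₀ ρ (1 / (m * t)) (c * f t ^ 2) := fun t ht => by
    have ht0 : 0 < t := by linarith
    obtain ⟨h1, h2, h3, h4⟩ := hφ t⁻¹ (by positivity) (inv_le_one_of_one_le₀ ht)
    refine .of_fProperty hΩ.1 hU hρU hr.2.1 hrm hm (by positivity) h1 h2 h3
      fun z hz hz1 hz2 => ?_
    have := (h4 z hz (by convert hz1 using 2; field_simp) hz2).1
    simpa using this
  have hβ0 : 0 < widenLoss := widenLoss_pos
  obtain ⟨ρ', hρ', T, hbase⟩ : ∃ ρ' > 0, ∃ T : ℝ, ∀ p ∈ ball z₀ ρ', p ∈ Ω →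
      ∃ Θ : Cn n → ℝ, IsPolar Ω p Θ ∧ (∀ z ∈ Ω, ‖z - p‖ < ρ' → 0 ≤ Θ z) ∧
        ∀ z ∈ Ω, z ≠ p → Θ z + log (‖z - p‖ ^ 2) ≤ T := by
    obtain ⟨t₁, ht₁, hft⟩ := hinf (1 + baseWidth / (c * (ρ / 4) ^ 2))
    set t := max t₁ (8 / (m * ρ)) with ht
    have ht1 : 1 ≤ t := ht₁.trans (le_max_left _ _)
    have ht0 : 0 < t := by linarith
    have hb8 := baseWidth_ge
    have h1 := hft t (le_max_left _ _)
    have h2 : 0 < baseWidth / (c * (ρ / 4) ^ 2) := by positivity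
    have h3 : baseWidth / (c * (ρ / 4) ^ 2) ≤ f t ^ 2 := by nlinarith
    refine exists_isPolar (δ := 1 / (m * t)) hS (by positivity) ?_
      (mul_pos hc (lt_of_lt_of_le h2 h3)) ?_ (hstrip t ht1)
    · have h4 : 8 / (m * ρ) ≤ t := le_max_right _ _
      rw [div_le_iff₀ (by positivity)] at h4
      rw [mul_one_div, div_le_iff₀ (by positivity)]
      linarith
    · rw [div_le_iff₀ (by positivity)] at h3
      linarith
  -- The strip for t = e/d has width d/(em), too thin to contain p; j preliminary widenings, with j
  -- independent of p, make it wider than d.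
  obtain ⟨j, hj⟩ : ∃ j : ℕ, exp 1 * m < (5 / 4 : ℝ) ^ j := pow_unbounded_of_one_lt _ (by norm_num)
  have hw0 := chainWidth_pos
  -- The three summands meet the three size conditions of `HasPolar.of_hasStrip`: the lateral radius
  -- against ρ/4, the same against ρ', and the strip width against ρ.
  set Kmin := chainWidth / (ρ / 4) ^ 2 + chainWidth / ρ' ^ 2 + 8 * (c / m) / ρ with hKmin
  have e1 : 0 < chainWidth / (ρ / 4) ^ 2 := by positivity
  have e2 : 0 < chainWidth / ρ' ^ 2 := by positivity
  have e3 : 0 < 8 * (c / m) / ρ := by positivity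
  have hK0 : 0 < Kmin := by positivity
  set C := max (T + log (Kmin / widenLoss)) (-1 + chainSlope * log (20 / 19)) with hC
  set M₁ := 4 * exp C * exp (1 + chainSlope * log 2) / (widenLoss ^ j * c) with hM₁
  set M₂ := 4 * exp T * (Kmin / (widenLoss ^ j * c)) with hM₂
  have hM₁0 : 0 < M₁ := by positivity
  have hM₂0 : 0 < M₂ := by positivity
  refine ⟨min (min (ρ / 4) ρ') 1, by positivity, √(M₁ + M₂), by positivity,
    fun p hp hpΩ h hd hmaps h0 => ?_⟩
  have hp1 : p ∈ ball z₀ (ρ / 4) :=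
    ball_subset_ball ((min_le_left _ _).trans (min_le_left _ _)) hp
  have hp2 : p ∈ ball z₀ ρ' := ball_subset_ball ((min_le_left _ _).trans (min_le_right _ _)) hp
  have hp3 : p ∈ ball z₀ 1 := ball_subset_ball (min_le_right _ _) hp
  set d := bdist Ω p with hdd
  have hd0 : 0 < d := hS.bdist_pos hpΩ
  have hd1 : d < 1 := lt_of_le_of_lt (infDist_le_dist_of_mem hz₀) (mem_ball.1 hp3)
  set t := exp 1 * d⁻¹ with ht
  have ht1 : 1 ≤ t := by
    have h1 : 1 ≤ d⁻¹ := (one_le_inv₀ hd0).2 hd1.le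
    have h2 : 1 ≤ exp 1 := one_le_exp zero_le_one
    nlinarith
  have ht0 : 0 < t := by linarith
  have hft := hf.2.2 t ht1
  have hft0 : 0 < f t := by linarith [hft.1]
  have hfsq : f t ^ 2 ≤ t := by
    have h1 : f t ^ 2 ≤ (t ^ (1 / 2 : ℝ)) ^ 2 := by have := hft.2; gcongr
    rwa [← Real.sqrt_eq_rpow, sq_sqrt ht0.le] at h1
  set δ₀ := 1 / (m * t) with hδ₀
  have hδ₀0 : 0 < δ₀ := by positivity
  set K := widenLoss ^ j * (c * f t ^ 2) with hK
  have hKpos : 0 < K := by positivity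
  have hS1 : HasStrip Ω z₀ ρ ((5 / 4) ^ j * δ₀) K := (hstrip t ht1).widen_iterate hS hδ₀0 j
  obtain ⟨Θ, hΘ, hΘlow, hΘT⟩ := hbase p hp2 hpΩ
  refine Real.le_sqrt_of_sq_le ?_
  rw [mul_pow]
  -- If K < Kmin, then f(t) is bounded and the fixed-scale function suffices; otherwise the chain is
  -- run.
  rcases lt_or_ge K Kmin with hKK | hKK
  · have h1 := hΘ.sq_deriv_mul_exp_le hΘT hΩ.1 hd hmaps h0
    have h2 : 1 ≤ exp (Θ p) := one_le_exp (hΘlow p hpΩ (by simpa using hρ'))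
    have h3 : ‖deriv h 0‖ ^ 2 ≤ 4 * exp T := by nlinarith [sq_nonneg ‖deriv h 0‖]
    have h4 : f t ^ 2 ≤ Kmin / (widenLoss ^ j * c) := by
      rw [le_div_iff₀ (by positivity)]
      have : K = f t ^ 2 * (widenLoss ^ j * c) := by rw [hK]; ring
      linarith
    calc ‖deriv h 0‖ ^ 2 * f t ^ 2 ≤ M₂ := by rw [hM₂]; gcongr
      _ ≤ _ := by linarith
  · obtain ⟨k, hk⟩ : ∃ k : ℕ, widenLoss ^ k * K < Kmin := by
      obtain ⟨k, hk⟩ := exists_pow_lt_of_lt_one (show 0 < Kmin / K by positivity)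
        (widenLoss_le.trans_lt (by norm_num : (1 / 2 : ℝ) < 1))
      exact ⟨k, (lt_div_iff₀ hKpos).1 hk⟩
    -- This is where f(t)² ≤ t enters.
    have hKδ : K * ((5 / 4) ^ j * δ₀) ≤ c / m := by
      have h1 : (widenLoss * (5 / 4)) ^ j ≤ 1 :=
        pow_le_one₀ (by positivity) (by have := widenLoss_le; linarith)
      have h2 : f t ^ 2 / t ≤ 1 := (div_le_one ht0).2 hfsq
      calc K * ((5 / 4) ^ j * δ₀) = (widenLoss * (5 / 4)) ^ j * (f t ^ 2 / t) * (c / m) := by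
            rw [hK, hδ₀, mul_pow]; field_simp
        _ ≤ 1 * 1 * (c / m) := by gcongr
        _ = c / m := by ring
    have hpol := HasPolar.of_hasStrip (A := c / m) (C := C) hS hK0 (by
        rw [← div_le_iff₀ (by positivity)]; linarith) hρ'
      (by rw [← div_le_iff₀ (by positivity)]; linarith)
      (by rw [mul_comm ρ, ← div_le_iff₀ hρ]; linarith) (le_max_right _ _) hp1 hpΩ
      (hΘ.add_const (log (Kmin / widenLoss)))
      (fun z hz hzp => by
        have := hΘT z hz hzp
        exact le_max_of_le_left (by linarith))
      (fun z hz hzp => by linarith [hΘlow z hz hzp]) k ((5 / 4) ^ j * δ₀) K (by positivity) hKK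
      hk hKδ hS1
    obtain ⟨Θ', hΘ', hΘ'C, hΘ'low⟩ := hpol
    have hdδ : d < (5 / 4) ^ j * δ₀ := by
      have h1 : exp 1 * m * δ₀ = d := by rw [hδ₀, ht]; field_simp
      rw [← h1]
      gcongr
    have h1 := hΘ'low p hpΩ hdδ (by simpa using hw0)
    rw [sub_self, norm_zero, zero_pow two_ne_zero, mul_zero, sub_zero, ← hdd] at h1
    have h2 : log (1 + d / ((5 / 4) ^ j * δ₀)) ≤ log 2 := by
      refine log_le_log (by positivity) ?_
      have := (div_le_one (show 0 < (5 / 4) ^ j * δ₀ by positivity)).2 hdδ.le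
      linarith
    have h3 := mul_le_mul_of_nonneg_left h2 chainSlope_pos.le
    have h4 : K ≤ exp (Θ' p) * exp (1 + chainSlope * log 2) := by
      rw [← exp_add, ← log_le_iff_le_exp hKpos]
      linarith
    have h5 := hΘ'.sq_deriv_mul_exp_le hΘ'C hΩ.1 hd hmaps h0
    calc ‖deriv h 0‖ ^ 2 * f t ^ 2 = ‖deriv h 0‖ ^ 2 * K / (widenLoss ^ j * c) := by
          rw [hK]; field_simp
      _ ≤ ‖deriv h 0‖ ^ 2 * (exp (Θ' p) * exp (1 + chainSlope * log 2)) / (widenLoss ^ j * c) := by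
          gcongr
      _ = (‖deriv h 0‖ ^ 2 * exp (Θ' p)) * exp (1 + chainSlope * log 2) / (widenLoss ^ j * c) := by
          ring
      _ ≤ M₁ := by rw [hM₁]; gcongr
      _ ≤ _ := by linarith

lemma nonempty_kobayashi (hΩ : IsOpen Ω) {z : Cn n} (hz : z ∈ Ω) (X : Cn n) :
    {α : ℝ | 0 < α ∧ ∃ h : ℂ → Cn n, DifferentiableOn ℂ h (ball 0 1) ∧
      Set.MapsTo h (ball 0 1) Ω ∧ h 0 = z ∧ deriv h 0 = (α : ℂ)⁻¹ • X}.Nonempty := by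
  obtain ⟨ε, hε, hb⟩ := Metric.isOpen_iff.1 hΩ z hz
  set α : ℝ := (‖X‖ + 1) / ε with hα
  have hα0 : 0 < α := by positivity
  have hX : ‖(α : ℂ)⁻¹ • X‖ < ε := by
    rw [norm_smul, norm_inv, Complex.norm_real, Real.norm_eq_abs, abs_of_pos hα0, hα, inv_div,
      div_mul_eq_mul_div, div_lt_iff₀ (by positivity)]
    nlinarith
  refine ⟨α, hα0, fun ζ => z + ζ • ((α : ℂ)⁻¹ • X), by fun_prop, fun ζ hζ => hb ?_, by simp, ?_⟩
  · rw [mem_ball, dist_eq_norm, add_sub_cancel_left, norm_smul]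
    have h1 : ‖ζ‖ ≤ 1 := (mem_ball_zero_iff.1 hζ).le
    exact (mul_le_of_le_one_left (norm_nonneg _) h1).trans_lt hX
  · have := (((hasDerivAt_id (0 : ℂ)).smul_const ((α : ℂ)⁻¹ • X)).const_add z).deriv
    simpa using this

end KobayashiBound

theorem theorem1p2 {n : ℕ} (Ω : Set (KobayashiBound.Cn n))
    (hΩ : KobayashiBound.Pseudoconvex Ω) (hC2 : KobayashiBound.HasC2Boundary Ω)
    (z₀ : KobayashiBound.Cn n) (hz₀ : z₀ ∈ frontier Ω)
    (f : ℝ → ℝ) (hf : KobayashiBound.IsRate f)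
    (hint : ∃ t : ℝ, 1 < t ∧
      MeasureTheory.IntegrableOn (fun a : ℝ => 1 / (a * f a)) (Set.Ioi t))
    (hF : KobayashiBound.FProperty Ω z₀ f) :
    ∃ V : Set (KobayashiBound.Cn n), IsOpen V ∧ z₀ ∈ V ∧ ∃ C : ℝ, 0 < C ∧
      ∀ z ∈ V ∩ Ω, ∀ X : KobayashiBound.Cn n,
        C * KobayashiBound.rateG f (KobayashiBound.bdist Ω z)⁻¹ * ‖X‖ ≤
          KobayashiBound.kobayashi Ω z X := by
  obtain ⟨t₀, ht₀, hint⟩ := hint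
  obtain ⟨ρ, hρ, M, hM, H⟩ := KobayashiBound.exists_deriv_bound hΩ hz₀ hf
    (hf.exists_le ht₀ hint) hF
  have ht₀' : 0 < t₀⁻¹ := by positivity
  refine ⟨Metric.ball z₀ (min ρ t₀⁻¹), Metric.isOpen_ball,
    Metric.mem_ball_self (lt_min hρ ht₀'), M⁻¹, by positivity, fun z hz X => ?_⟩
  have hd0 : 0 < KobayashiBound.bdist Ω z := KobayashiBound.bdist_pos hΩ.1 ⟨z₀, hz₀⟩ hz.2
  have hd : KobayashiBound.bdist Ω z < t₀⁻¹ :=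
    lt_of_le_of_lt (Metric.infDist_le_dist_of_mem hz₀) ((Metric.mem_ball.1 hz.1).trans_le
      (min_le_right _ _))
  have hG := hf.rateG_le ht₀ hint ((le_inv_comm₀ (by positivity) hd0).2 hd.le)
  -- Nonemptiness matters: the infimum of the empty set of reals is 0 by convention.
  refine le_csInf (KobayashiBound.nonempty_kobayashi hΩ.1 hz.2 X) ?_
  rintro α ⟨hα, h, h1, h2, h3, h4⟩
  have h5 := H z (Metric.ball_subset_ball (min_le_left _ _) hz.1) hz.2 h h1 h2 h3
  rw [h4, norm_smul, norm_inv, Complex.norm_real, Real.norm_eq_abs, abs_of_pos hα] at h5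
  have h6 : ‖X‖ * f (Real.exp 1 * (KobayashiBound.bdist Ω z)⁻¹) ≤ M * α := by
    rw [inv_mul_eq_div, div_mul_eq_mul_div, div_le_iff₀ hα] at h5
    exact h5
  rw [mul_assoc, inv_mul_le_iff₀ hM]
  have h7 := mul_le_mul_of_nonneg_right hG (norm_nonneg X)
  linarith
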